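/- Let $q_0,q_1,q_2$ be the vertices of an equilateral triangle of height $1$ with top vertex $q_0$ and horizontal bottom edge $q_1q_2$, let $F_i(p)=\frac12(p+q_i)$, and let $\mathcal{SG}$ be the Sierpinski gasket, the nonempty compact set with $\mathcal{SG}=\bigcup_{i}F_i(\mathcal{SG})$. Let $0<x\le 1$ be a real number that is not a dyadic rational, written as $x=\sum_{k\ge1}2^{-n_k}$ with integers $0<n_1<n_2<\cdots$, and put $n_0=0$. Let $\Omega_x$ be the set of points of $\mathcal{SG}$ strictly above the horizontal line $L_x$ at distance $x$ from $q_0$, and let $S(x)=\mathcal{SG}\cap L_x$. For a word $\omega=(\omega_1,\dots,\omega_m)$ of letters $\omega_j\in\{1,2\}$, $m=|\omega|\ge0$, put $$\tilde F_\omega=F_0^{n_1-n_0-1}F_{\omega_1}F_0^{n_2-n_1-1}F_{\omega_2}\cdots F_0^{n_m-n_{m-1}-1}F_{\omega_m},\qquad S_\omega(x)=S(x)\cap\tilde F_\omega(\mathcal{SG}).$$ Let $\mu$ be the Cantor probability measure on $S(x)$, with $\mu(S_\omega(x))=2^{-|\omega|}$ for all $\omega$, and let $\psi_\omega$ be the Haar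 function equal to $2^{m/2}$ on $S_{\omega1}(x)$, to $-2^{m/2}$ on $S_{\omega2}(x)$, and to $0$ elsewhere. For a real function $u$ on $\Omega_x$, the energy $\mathcal E(u)\in[0,\infty]$ is the limit as $k\to\infty$ of $(5/3)^k\sum(u(z)-u(z'))^2$, the sum being over the edges $\{z,z'\}$ of the cells $F_{w_1}\cdots F_{w_k}(\mathcal{SG})$ of level $k$ contained in $\Omega_x$ (this is nondecreasing in $k$). Let $a\in\mathbb R$ and $f\in L^1(S(x),\mu)$, and put $$b=\int_{S(x)}f\,d\mu,\qquad c_\omega=\int_{S(x)}f\psi_\omega\,d\mu ,$$ so that $f$ has the Haar expansion $b+\sum_\omega c_\omega\psi_\omega$. Let $h$ be the harmonic function on $\Omega_x$ with boundary values $a$ at $q_0$ and $f$ on $S(x)$; that is, $h$ is continuous on $\Omega_x$, $\Delta h=0$ on $\Omega_x\setminus\{q_0\}$ for the Kigami Laplacian $\Delta$ of $\mathcal{SG}$, $h(q_0)=a$, and the functions equal to $h(\tilde F_\omega q_0)$ on $S_\omega(x)$ for $|\omega|=m$ converge to $f$ in $L^1(\mu)$ as $m\to\infty$ (as they do, in particular,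 if $h$ extends continuously to $\Omega_x\cup S(x)$ with $h|_{S(x)}=f$). Then there are constants $0<C_1\le C_2<\infty$, independent of $x$, $a$, $f$ and $h$, such that $C_1Q\le\mathcal E(h)\le C_2Q$, where $$Q=\left(\tfrac53\right)^{n_1}(a-b)^2+\sum_{m=0}^{\infty}\sum_{|\omega|=m}2^m\left(\tfrac53\right)^{n_{m+1}}|c_\omega|^2\in[0,\infty].$$ In particular, $h$ has finite energy if and only if $Q$ is finite. -/

import Mathlib

open Filter Topology MeasureTheory
open scoped ENNReal NNReal

namespace SGDomain

noncomputable section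

/-! ### The Sierpinski gasket -/

/-- The Euclidean plane; the second coordinate `p 1` is the height of a point `p`. -/
abbrev Plane : Type := EuclideanSpace ℝ (Fin 2)

/-- The vertices of an equilateral triangle of height `1`; `q 0` is the top vertex, the other two
lie at height `0`. -/
def q : Fin 3 → Plane :=
  ![!₂[0, 1], !₂[-(1 / Real.sqrt 3), 0], !₂[1 / Real.sqrt 3, 0]]

/-- The contraction of ratio `1/2` with fixed point `q i`. -/
def F (i : Fin 3) (p : Plane) : Plane := (1 / 2 : ℝ) • (p + q i)

/-- The point `lim F_{d 0} ∘ ⋯ ∘ F_{d k} (p)` with address `d`. -/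
def address (d : ℕ → Fin 3) : Plane := ∑' k, (1 / 2 : ℝ) ^ (k + 1) • q (d k)

/-- The Sierpinski gasket. It is the unique nonempty compact set that equals the union of its
images under the three maps `F i`; see `isCompact_gasket`, `gasket_nonempty` and `gasket_eq`. -/
def gasket : Set Plane := Set.range address

/-- The composition `F (w 0) ∘ F (w 1) ∘ ⋯ ∘ F (w (m - 1))`. -/
def wordMap : (m : ℕ) → (Fin m → Fin 3) → Plane → Plane
  | 0, _ => id
  | m + 1, w => F (w 0) ∘ wordMap m (Fin.tail w)

open Classical in
/-- The vertices `V_m` of the level `m` graph approximation of the gasket. -/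
def vertices (m : ℕ) : Finset Plane :=
  Finset.univ.image fun v : (Fin m → Fin 3) × Fin 3 => wordMap m v.1 (q v.2)

/-- The edges of the level `m` graph: two distinct corners of a common cell of level `m`. -/
def Adj (m : ℕ) (z z' : Plane) : Prop :=
  ∃ (w : Fin m → Fin 3) (i j : Fin 3), i ≠ j ∧ z = wordMap m w (q i) ∧ z' = wordMap m w (q j)

open Classical in
/-- The graph Laplacian of level `m`, the sum of `u z' - u z` over the neighbours `z'` of `z`. -/
def graphLaplacian (m : ℕ) (u : Plane → ℝ) (z : Plane) : ℝ :=
  ∑ z' ∈ (vertices m).filter (Adj m z), (u z' - u z)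

/-- `Δ u = f` on the relatively open subset `U` of the gasket, for the Kigami Laplacian
`Δ u = (3/2) lim 5 ^ m Δ_m u` (the limit being locally uniform on the vertices other than the three
corners of the gasket). -/
def HasLaplacianOn (u f : Plane → ℝ) (U : Set Plane) : Prop :=
  ContinuousOn u U ∧ ContinuousOn f U ∧
    ∀ K ⊆ U, IsCompact K → ∀ ε > 0, ∃ M, ∀ m ≥ M, ∀ z ∈ K, z ∈ vertices m → z ∉ vertices 0 →
      |3 / 2 * 5 ^ m * graphLaplacian m u z - f z| < ε

open Classical in
/-- The renormalized graph energy of level `m`, taken over the cells of level `m` contained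
in `Ω`. -/
def graphEnergy (Ω : Set Plane) (m : ℕ) (u : Plane → ℝ) : ℝ :=
  (5 / 3) ^ m * ∑ w ∈ Finset.univ.filter fun w : Fin m → Fin 3 => wordMap m w '' gasket ⊆ Ω,
    ((u (wordMap m w (q 0)) - u (wordMap m w (q 1))) ^ 2
      + (u (wordMap m w (q 1)) - u (wordMap m w (q 2))) ^ 2
      + (u (wordMap m w (q 2)) - u (wordMap m w (q 0))) ^ 2)

/-- The energy of `u` on `Ω`. The graph energies increase with the level, so that the supremum is
their limit. -/
def energy (Ω : Set Plane) (u : Plane → ℝ) : ℝ≥0∞ :=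
  ⨆ m, ENNReal.ofReal (graphEnergy Ω m u)

/-! ### The domain `Ω_x` and the Cantor set `S(x)` -/

/-- The part of the gasket strictly above the horizontal line at distance `x` from `q 0`. -/
def Ω (x : ℝ) : Set Plane := {p | p ∈ gasket ∧ 1 - x < p 1}

/-- The intersection of the gasket with the horizontal line at distance `x` from `q 0`. -/
def S (x : ℝ) : Set Plane := {p | p ∈ gasket ∧ p 1 = 1 - x}

/-- `x = ∑_{k ≥ 1} 2 ^ (-n k)` with `0 < n 1 < n 2 < ⋯`; the value `n 0 = 0` is a convention. -/
structure IsBinaryExpansion (x : ℝ) (n : ℕ → ℕ) : Prop where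
  zero : n 0 = 0
  strictMono : StrictMono n
  hasSum : HasSum (fun k => (1 / 2 : ℝ) ^ n (k + 1)) x

/-- The map `F_0^{n 1 - 1} F_{ω_1} F_0^{n 2 - n 1 - 1} F_{ω_2} ⋯ F_0^{n m - n (m-1) - 1} F_{ω_m}`.
The letters `1` and `2` of the words `ω` are encoded as the elements `0` and `1` of `Fin 2`. -/
def cellMap (n : ℕ → ℕ) : (m : ℕ) → (Fin m → Fin 2) → Plane → Plane
  | 0, _ => id
  | m + 1, ω =>
    cellMap n m (Fin.init ω) ∘ (F 0)^[n (m + 1) - n m - 1] ∘ F (ω (Fin.last m)).succ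

/-- The dyadic piece `S_ω(x)` of `S(x)`. -/
def piece (x : ℝ) (n : ℕ → ℕ) (m : ℕ) (ω : Fin m → Fin 2) : Set Plane :=
  S x ∩ cellMap n m ω '' gasket

/-- The limit, as `m → ∞`, of the top vertices of the cells of the initial segments of length `m`
of the infinite word `σ`; see `tendsto_cellMap`. -/
def boundaryPoint (n : ℕ → ℕ) (σ : ℕ → Fin 2) : Plane :=
  q 0 + ∑' j, (1 / 2 : ℝ) ^ n (j + 1) • (q (σ j).succ - q 0)

/-- The law of an infinite word with independent, uniformly distributed letters. -/
def coin : Measure (ℕ → Fin 2) :=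
  Measure.infinitePi fun _ => ProbabilityTheory.uniformOn (Set.univ : Set (Fin 2))

/-- The Cantor measure on `S(x)`, which gives mass `2 ^ (-m)` to each piece of level `m`. -/
def cantorMeasure (n : ℕ → ℕ) : Measure Plane := coin.map (boundaryPoint n)

open Classical in
/-- The Haar function `ψ_ω`, `|ω| = m`: equal to `2 ^ (m / 2)` on `S_{ω1}(x)`, to `-2 ^ (m / 2)` on
`S_{ω2}(x)`, and to `0` elsewhere. -/
def haar (x : ℝ) (n : ℕ → ℕ) (m : ℕ) (ω : Fin m → Fin 2) (p : Plane) : ℝ :=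
  if p ∈ piece x n (m + 1) (Fin.snoc ω 0) then (2 : ℝ) ^ ((m : ℝ) / 2)
  else if p ∈ piece x n (m + 1) (Fin.snoc ω 1) then -(2 : ℝ) ^ ((m : ℝ) / 2)
  else 0

/-- The Haar coefficient `∫ f ψ_ω dμ` over `S(x)`. -/
def haarCoeff (x : ℝ) (n : ℕ → ℕ) (f : Plane → ℝ) (m : ℕ) (ω : Fin m → Fin 2) : ℝ :=
  ∫ p in S x, f p * haar x n m ω p ∂cantorMeasure n

/-! ### Harmonic functions with given boundary values -/

/-- `f` is the boundary value of `h` on `S(x)` in the sense of `L¹`: the values of `h` at the top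
vertices of the `2 ^ m` cells of level `m` around `S(x)`, spread over the corresponding
pieces of `S(x)`, converge to `f` in `L¹` of the Cantor measure. This holds in particular if `h`
is continuous up to `S(x)` and agrees with `f` there; see `hasTrace_of_continuousOn`. -/
def HasTrace (n : ℕ → ℕ) (h f : Plane → ℝ) : Prop :=
  Tendsto (fun m => ∫⁻ σ, ‖h (cellMap n m (fun i => σ i) (q 0)) - f (boundaryPoint n σ)‖ₑ ∂coin)
    atTop (𝓝 0)

/-- `h` is a harmonic function on `Ω_x` with boundary values `a` at `q 0` and `f` on `S(x)`. -/
structure IsHarmonicWith (x : ℝ) (n : ℕ → ℕ) (a : ℝ) (f h : Plane → ℝ) : Prop where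
  continuousOn : ContinuousOn h (Ω x)
  laplacian : HasLaplacianOn h 0 (Ω x \ {q 0})
  top : h (q 0) = a
  trace : HasTrace n h f

/-! ### Facts that justify the definitions -/

lemma norm_q_le (i : Fin 3) : ‖q i‖ ≤ 2 := by
  have h3 : (Real.sqrt 3)⁻¹ ^ 2 = 1 / 3 := by rw [inv_pow, Real.sq_sqrt (by norm_num)]; norm_num
  rw [EuclideanSpace.norm_eq]
  apply Real.sqrt_le_iff.2
  fin_cases i <;> simp [q, Fin.sum_univ_two] <;> nlinarith [h3]

lemma summable_half : Summable fun k : ℕ => (1 / 2 : ℝ) ^ (k + 1) * 2 :=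
  ((summable_nat_add_iff 1).2 summable_geometric_two).mul_right 2

lemma norm_address_term (d : ℕ → Fin 3) (k : ℕ) :
    ‖(1 / 2 : ℝ) ^ (k + 1) • q (d k)‖ ≤ (1 / 2 : ℝ) ^ (k + 1) * 2 := by
  rw [norm_smul, Real.norm_of_nonneg (by positivity)]
  gcongr
  exact norm_q_le _

lemma continuous_address : Continuous address := by
  refine continuous_tsum (fun k => ?_) summable_half fun k d => norm_address_term d k
  have h1 : Continuous fun d : ℕ → Fin 3 => q (d k) :=
    (continuous_of_discreteTopology (f := q)).comp (continuous_apply (A := fun _ => Fin 3) k)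
  exact (continuous_const (y := (1 / 2 : ℝ) ^ (k + 1))).smul h1

theorem isCompact_gasket : IsCompact gasket := isCompact_range continuous_address

theorem gasket_nonempty : gasket.Nonempty := Set.range_nonempty _

lemma address_eq (d : ℕ → Fin 3) : address d = F (d 0) (address fun k => d (k + 1)) := by
  have hs : ∀ d : ℕ → Fin 3, Summable fun k => (1 / 2 : ℝ) ^ (k + 1) • q (d k) := fun d =>
    Summable.of_norm_bounded summable_half (norm_address_term d)
  have h1 : HasSum (fun k => (1 / 2 : ℝ) ^ (k + 1 + 1) • q (d (k + 1)))
      ((1 / 2 : ℝ) • address fun k => d (k + 1)) := by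
    have := ((hs fun k => d (k + 1)).hasSum).const_smul (1 / 2 : ℝ)
    refine this.congr_fun fun k => ?_
    rw [smul_smul, pow_succ' _ (k + 1)]
  rw [address, (hs d).tsum_eq_zero_add, h1.tsum_eq, F, smul_add, add_comm]
  simp

theorem gasket_eq : gasket = ⋃ i, F i '' gasket := by
  ext p
  simp only [Set.mem_iUnion, gasket, Set.mem_range, Set.mem_image, exists_exists_eq_and]
  constructor
  · rintro ⟨d, rfl⟩
    exact ⟨d 0, fun k => d (k + 1), (address_eq d).symm⟩
  · rintro ⟨i, d, rfl⟩
    let d' : ℕ → Fin 3 := fun k => if k = 0 then i else d (k - 1)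
    refine ⟨d', ?_⟩
    have h1 : (fun k => d' (k + 1)) = d := by funext k; simp [d']
    have h2 : d' 0 = i := by simp [d']
    rw [address_eq d', h1, h2]

lemma F_mem {p : Plane} (i : Fin 3) (hp : p ∈ gasket) : F i p ∈ gasket := by
  rw [gasket_eq]
  exact Set.mem_iUnion.2 ⟨i, p, hp, rfl⟩

lemma iterate_mem {p : Plane} (hp : p ∈ gasket) (k : ℕ) : (F 0)^[k] p ∈ gasket := by
  induction k with
  | zero => exact hp
  | succ k ih => rw [Function.iterate_succ_apply']; exact F_mem 0 ih

lemma q_mem (i : Fin 3) : q i ∈ gasket := by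
  refine ⟨fun _ => i, ?_⟩
  have h1 : HasSum (fun k : ℕ => (1 / 2 : ℝ) ^ (k + 1)) 1 := by
    have := hasSum_geometric_two.mul_right (1 / 2 : ℝ)
    norm_num at this
    simpa [pow_succ] using this
  have h2 := (h1.smul_const (q i)).tsum_eq
  rwa [one_smul] at h2

lemma cellMap_mem (n : ℕ → ℕ) (m : ℕ) (ω : Fin m → Fin 2) {p : Plane} (hp : p ∈ gasket) :
    cellMap n m ω p ∈ gasket := by
  induction m generalizing p with
  | zero => exact hp
  | succ m ih => exact ih _ (iterate_mem (F_mem _ hp) _)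

lemma iterate_F (k : ℕ) (p : Plane) : (F 0)^[k] p = q 0 + (1 / 2 : ℝ) ^ k • (p - q 0) := by
  induction k with
  | zero => simp
  | succ k ih =>
    rw [Function.iterate_succ_apply', ih, F, pow_succ]
    module

lemma cellMap_apply {n : ℕ → ℕ} (h0 : n 0 = 0) (hn : StrictMono n) (m : ℕ) (ω : Fin m → Fin 2)
    (p : Plane) :
    cellMap n m ω p = q 0 + ∑ j : Fin m, (1 / 2 : ℝ) ^ n (j + 1) • (q (ω j).succ - q 0)
      + (1 / 2 : ℝ) ^ n m • (p - q 0) := by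
  induction m generalizing p with
  | zero => simp [cellMap, h0]
  | succ m ih =>
    have hlt : n m < n (m + 1) := hn (Nat.lt_succ_self m)
    obtain ⟨k, hk⟩ : ∃ k, n (m + 1) = n m + k + 1 := ⟨n (m + 1) - n m - 1, by omega⟩
    rw [cellMap, Function.comp_apply, Function.comp_apply, ih, iterate_F, Fin.sum_univ_castSucc]
    have hk' : n (m + 1) - n m - 1 = k := by omega
    rw [hk']
    simp only [Fin.init, Fin.val_castSucc, Fin.val_last, F, hk, pow_succ, pow_add]
    module

lemma IsBinaryExpansion.summable {x : ℝ} {n : ℕ → ℕ} (hx : IsBinaryExpansion x n) :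
    Summable fun j : ℕ => (1 / 2 : ℝ) ^ n (j + 1) * 4 :=
  hx.hasSum.summable.mul_right 4

lemma norm_boundary_term (n : ℕ → ℕ) (σ : ℕ → Fin 2) (j : ℕ) :
    ‖(1 / 2 : ℝ) ^ n (j + 1) • (q (σ j).succ - q 0)‖ ≤ (1 / 2 : ℝ) ^ n (j + 1) * 4 := by
  rw [norm_smul, Real.norm_of_nonneg (by positivity)]
  gcongr
  linarith [norm_sub_le (q (σ j).succ) (q 0), norm_q_le (σ j).succ, norm_q_le 0]

lemma continuous_boundaryPoint {x : ℝ} {n : ℕ → ℕ} (hx : IsBinaryExpansion x n) :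
    Continuous (boundaryPoint n) := by
  refine continuous_const.add
    (continuous_tsum (fun k => ?_) hx.summable fun k σ => norm_boundary_term n σ k)
  have h1 : Continuous fun σ : ℕ → Fin 2 => q (σ k).succ - q 0 :=
    (continuous_of_discreteTopology (f := fun i : Fin 2 => q i.succ - q 0)).comp
      (continuous_apply (A := fun _ => Fin 2) k)
  exact (continuous_const (y := (1 / 2 : ℝ) ^ n (k + 1))).smul h1

instance : IsProbabilityMeasure coin := by unfold coin; infer_instance

theorem isProbabilityMeasure_cantorMeasure {x : ℝ} {n : ℕ → ℕ} (hx : IsBinaryExpansion x n) :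
    IsProbabilityMeasure (cantorMeasure n) :=
  Measure.isProbabilityMeasure_map (continuous_boundaryPoint hx).measurable.aemeasurable

theorem tendsto_cellMap {x : ℝ} {n : ℕ → ℕ} (hx : IsBinaryExpansion x n) (σ : ℕ → Fin 2)
    (p : Plane) :
    Tendsto (fun m => cellMap n m (fun i => σ i) p) atTop (𝓝 (boundaryPoint n σ)) := by
  have h1 : HasSum (fun j => (1 / 2 : ℝ) ^ n (j + 1) • (q (σ j).succ - q 0))
      (∑' j, (1 / 2 : ℝ) ^ n (j + 1) • (q (σ j).succ - q 0)) :=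
    (Summable.of_norm_bounded hx.summable (norm_boundary_term n σ)).hasSum
  have h2 : Tendsto (fun m => (1 / 2 : ℝ) ^ n m • (p - q 0)) atTop (𝓝 0) := by
    have := ((tendsto_pow_atTop_nhds_zero_of_lt_one (r := (1 / 2 : ℝ)) (by norm_num)
      (by norm_num)).comp hx.strictMono.tendsto_atTop).smul_const (p - q 0)
    simpa using this
  have h3 := (h1.tendsto_sum_nat.const_add (q 0)).add h2
  rw [add_zero] at h3
  refine h3.congr fun m => ?_
  rw [cellMap_apply hx.zero hx.strictMono]
  congr 2
  exact (Fin.sum_univ_eq_sum_range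
    (fun j => (1 / 2 : ℝ) ^ n (j + 1) • (q (σ j).succ - q 0)) m).symm

lemma height_q (i : Fin 2) : (q i.succ - q 0 : Plane) 1 = -1 := by
  fin_cases i <;> simp [q]

lemma height_cellMap {x : ℝ} {n : ℕ → ℕ} (hx : IsBinaryExpansion x n) (σ : ℕ → Fin 2) (m : ℕ) :
    (cellMap n m (fun i => σ i) (q 0)) 1
      = 1 - ∑ j ∈ Finset.range m, (1 / 2 : ℝ) ^ n (j + 1) := by
  rw [cellMap_apply hx.zero hx.strictMono, sub_self, smul_zero, add_zero, PiLp.add_apply,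
    WithLp.ofLp_sum, Finset.sum_apply]
  simp_rw [PiLp.smul_apply, height_q]
  rw [Fin.sum_univ_eq_sum_range (fun j => (1 / 2 : ℝ) ^ n (j + 1) • (-1 : ℝ)) m]
  simp [q, sub_eq_add_neg]

lemma cellMap_mem_Ω {x : ℝ} {n : ℕ → ℕ} (hx : IsBinaryExpansion x n) (σ : ℕ → Fin 2) (m : ℕ) :
    cellMap n m (fun i => σ i) (q 0) ∈ Ω x := by
  refine ⟨cellMap_mem _ _ _ (q_mem 0), ?_⟩
  rw [height_cellMap hx]
  have := hx.hasSum.summable.sum_le_tsum (Finset.range (m + 1)) fun _ _ => by positivity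
  rw [hx.hasSum.tsum_eq, Finset.sum_range_succ] at this
  have : (0 : ℝ) < (1 / 2) ^ n (m + 1) := by positivity
  linarith

theorem boundaryPoint_mem {x : ℝ} {n : ℕ → ℕ} (hx : IsBinaryExpansion x n) (σ : ℕ → Fin 2) :
    boundaryPoint n σ ∈ S x := by
  have h1 := tendsto_cellMap hx σ (q 0)
  refine ⟨isCompact_gasket.isClosed.mem_of_tendsto h1
    (Eventually.of_forall fun m => cellMap_mem _ _ _ (q_mem 0)), ?_⟩
  have h2 : Tendsto (fun m => (cellMap n m (fun i => σ i) (q 0)) 1) atTop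
      (𝓝 (boundaryPoint n σ 1)) :=
    ((continuous_apply (1 : Fin 2)).comp (PiLp.continuous_ofLp 2 _)).continuousAt.tendsto.comp h1
  simp_rw [height_cellMap hx] at h2
  exact tendsto_nhds_unique h2 (hx.hasSum.tendsto_sum_nat.const_sub 1)

/-- Boundary values in the classical sense are boundary values in the sense of `HasTrace`. -/
theorem hasTrace_of_continuousOn {x : ℝ} {n : ℕ → ℕ} (hx : IsBinaryExpansion x n)
    {h f : Plane → ℝ} (hh : ContinuousOn h (Ω x ∪ S x)) (hf : Set.EqOn h f (S x)) :
    HasTrace n h f := by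
  have hc : IsCompact (Ω x ∪ S x) := by
    have : Ω x ∪ S x = gasket ∩ {p : Plane | 1 - x ≤ p 1} := by
      ext p
      simp only [Ω, S, Set.mem_union, Set.mem_inter_iff, Set.mem_ofPred_eq, le_iff_lt_or_eq,
        eq_comm (a := 1 - x)]
      tauto
    rw [this]
    exact isCompact_gasket.inter_right (isClosed_le continuous_const
      ((continuous_apply (1 : Fin 2)).comp (PiLp.continuous_ofLp 2 _)))
  obtain ⟨C, hC⟩ := hc.exists_bound_of_continuousOn hh
  have hb : ∀ σ, boundaryPoint n σ ∈ Ω x ∪ S x := fun σ => Or.inr (boundaryPoint_mem hx σ)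
  have hcell : ∀ (σ : ℕ → Fin 2) (m : ℕ), cellMap n m (fun i : Fin m => σ i) (q 0) ∈ Ω x ∪ S x :=
    fun σ m => Or.inl (cellMap_mem_Ω hx σ m)
  have hcont : Continuous fun σ => h (boundaryPoint n σ) :=
    hh.comp_continuous (continuous_boundaryPoint hx) hb
  have e : ∀ σ, f (boundaryPoint n σ) = h (boundaryPoint n σ) :=
    fun σ => (hf (boundaryPoint_mem hx σ)).symm
  unfold HasTrace
  simp_rw [e]
  have key := tendsto_lintegral_of_dominated_convergence (μ := coin)
    (F := fun m σ => ‖h (cellMap n m (fun i => σ i) (q 0)) - h (boundaryPoint n σ)‖ₑ)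
    (f := fun _ => 0) (fun _ => ENNReal.ofReal (C + C)) (fun m => ?_) (fun m => ?_) ?_ ?_
  · simpa using key
  · have h1 : Continuous fun σ : ℕ → Fin 2 => h (cellMap n m (fun i => σ i) (q 0)) :=
      (continuous_of_discreteTopology (f := fun ω : Fin m → Fin 2 => h (cellMap n m ω (q 0)))).comp
        (continuous_pi fun i => continuous_apply (i : ℕ))
    exact (h1.sub hcont).enorm.measurable
  · refine Eventually.of_forall fun σ => ?_
    change ‖h (cellMap n m (fun i => σ i) (q 0)) - h (boundaryPoint n σ)‖ₑ ≤ _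
    rw [← ofReal_norm]
    exact ENNReal.ofReal_le_ofReal
      ((norm_sub_le _ _).trans (add_le_add (hC _ (hcell σ m)) (hC _ (hb σ))))
  · simp
  · refine Eventually.of_forall fun σ => ?_
    have h1 : Tendsto (fun m => h (cellMap n m (fun i => σ i) (q 0))) atTop
        (𝓝 (h (boundaryPoint n σ))) :=
      (hh _ (hb σ)).tendsto.comp (tendsto_nhdsWithin_iff.2
        ⟨tendsto_cellMap hx σ (q 0), Eventually.of_forall fun m => hcell σ m⟩)
    have h2 := (h1.sub_const (h (boundaryPoint n σ))).enorm
    simpa using h2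

end

end SGDomain

/-!
The line at distance `x` from the top cuts the gasket so that `Ω_x` is a binary tree of cells: for
every finite word `ω` of length `m` there is one maximal cell above the line (`triangle n m ω`), of
level `n (m + 1)`. Its top vertex is `cellMap n m ω (q 0)` and its two bottom vertices are the top
vertices of the maximal cells of the two continuations of `ω`.

*Reduction to the tree.* A vanishing Laplacian makes `h` graph harmonic at every junction point whose
adjacent cells lie in `Ω_x` (`junctionLaplacian_eq_zero`): a graph Laplacian is `5/3` times a
combination, with weights of sum `3`, of graph Laplacians of the next level, so `5 ^ k` times
its supremum does not decrease with the level `k`, while it tends to `0`. Near `q 0`, where the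
Laplacian is not controlled, continuity of `h` takes its place (`apexLaplacian_eq_zero`). Hence
the energy of `h` is the sum over the maximal cells of their renormalized triangle energies
(`energy_eq_tsum`), and the flux `J_ω` into a maximal cell equals the flux out of the cell above it
(`IsHarmonicWith.flux_snoc`).

*Linear algebra on the tree.* Let `r_m = (5/3) ^ n (m + 1)` be the conductance of generation `m`,
`h_ω` the value at the top vertex, and `d_ω = h_ω1 - h_ω2`. Then `J_ω1 + J_ω2 = J_ω` and
`J_ω1 - J_ω2 = -3 r_m d_ω`, and the maximal cell has energy `J_ω ^ 2 / (2 r_m) + (3/2) r_m d_ω ^ 2`.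
Since `r_m` grows at least by the factor `5/3`, the energies of the fluxes decay geometrically up to
the contribution of the jumps, and the total energy is comparable to
`J_∅ ^ 2 / r_0 + ∑ r_m d_ω ^ 2` (`IsHarmonicWith.sum_fluxEnergy_le`).

*Boundary values.* Averaging `h` over the descendants of `ω` and passing to the limit, the mean of
`f` over the piece of `ω` is `h_ω - J_ω R_m`, where `R_m` is an effective resistance with
`1/2 ≤ r_m R_m ≤ 5/7` (`IsHarmonicWith.setIntegral_boundary`). For the empty word this gives
`a - b = J_∅ R_0`; for the two continuations of `ω` it shows that the Haar coefficient `c_ω` is `d_ω`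
times `2 ^ (m / 2 - m - 1) (1 + 3 r_m R_{m + 1})`, so that `2 ^ m r_m c_ω ^ 2` is comparable to
`r_m d_ω ^ 2` (`IsHarmonicWith.haarCoeff_eq`).
-/

namespace SGDomain

/-! ### Cells, addressed by lists of letters -/

/-- The composition of the maps `F i` along a list of letters; the cell with address `l` is the
image of the gasket. Lists replace the words `Fin m → Fin 3` so that addresses can be
concatenated. -/
noncomputable def cell : List (Fin 3) → Plane → Plane
  | [] => id
  | i :: l => F i ∘ cell l

lemma cell_append (l l' : List (Fin 3)) (p : Plane) : cell (l ++ l') p = cell l (cell l' p) := by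
  induction l with
  | nil => rfl
  | cons i l ih => simp [cell, ih]

lemma wordMap_eq_cell (m : ℕ) (w : Fin m → Fin 3) : wordMap m w = cell (List.ofFn w) := by
  induction m with
  | zero => simp [wordMap, cell]
  | succ m ih => rw [wordMap, List.ofFn_succ, cell, ih]; rfl

lemma exists_ofFn {m : ℕ} {l : List (Fin 3)} (hl : l.length = m) :
    ∃ w : Fin m → Fin 3, List.ofFn w = l := by
  subst hl
  exact ⟨l.get, List.ofFn_get l⟩

lemma cell_mem (l : List (Fin 3)) {p : Plane} (hp : p ∈ gasket) : cell l p ∈ gasket := by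
  induction l with
  | nil => exact hp
  | cons i l ih => exact F_mem i ih

lemma F_injective (i : Fin 3) : Function.Injective (F i) := by
  intro p p' h
  have h2 : (2 : ℝ) • F i p = (2 : ℝ) • F i p' := by rw [h]
  simpa [F, smul_smul] using h2

lemma cell_injective (l : List (Fin 3)) : Function.Injective (cell l) := by
  induction l with
  | nil => exact Function.injective_id
  | cons i l ih => exact (F_injective i).comp ih

lemma continuous_cell (l : List (Fin 3)) : Continuous (cell l) := by
  induction l with
  | nil => exact continuous_id
  | cons i l ih =>
    have : Continuous (F i) := by unfold F; fun_prop
    exact this.comp ih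

lemma isCompact_cell (l : List (Fin 3)) : IsCompact (cell l '' gasket) :=
  isCompact_gasket.image (continuous_cell l)

lemma cell_append_subset (l l' : List (Fin 3)) : cell (l ++ l') '' gasket ⊆ cell l '' gasket := by
  rintro _ ⟨p, hp, rfl⟩
  exact ⟨cell l' p, cell_mem l' hp, (cell_append l l' p).symm⟩

lemma F_q (i : Fin 3) : F i (q i) = q i := by
  rw [F]; module

lemma F_q_comm (i j : Fin 3) : F i (q j) = F j (q i) := by
  rw [F, F, add_comm]

lemma cell_replicate (k : ℕ) (i : Fin 3) : cell (List.replicate k i) (q i) = q i := by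
  induction k with
  | zero => rfl
  | succ k ih => simp [List.replicate_succ, cell, ih, F_q]

/-- The two addresses of a junction point. -/
lemma cell_junction (v : List (Fin 3)) (i j : Fin 3) (k : ℕ) :
    cell (v ++ i :: List.replicate k j) (q j) = cell (v ++ j :: List.replicate k i) (q i) := by
  simp [cell_append, cell, cell_replicate, F_q_comm i j]

/-! ### Barycentric coordinates -/

/-- The barycentric coordinates with respect to the triangle `q 0`, `q 1`, `q 2`. -/
noncomputable def bary (i : Fin 3) (p : Plane) : ℝ :=
  ![p 1, (1 - p 1 - √3 * p 0) / 2, (1 - p 1 + √3 * p 0) / 2] i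

lemma bary_F (i j : Fin 3) (p : Plane) :
    bary i (F j p) = (bary i p + if i = j then 1 else 0) / 2 := by
  have h3 : √3 * (√3)⁻¹ = 1 := mul_inv_cancel₀ (by positivity)
  fin_cases i <;> fin_cases j <;> simp [bary, F, q] <;>
    first | ring1 | linear_combination (1 / 2 : ℝ) * h3 | linear_combination -(1 / 2 : ℝ) * h3

lemma continuous_bary (i : Fin 3) : Continuous (bary i) := by
  unfold bary
  fin_cases i <;> simp only [Fin.zero_eta, Fin.mk_one, Fin.reduceFinMk, Matrix.cons_val] <;> fun_prop

lemma bary_sum (p : Plane) : bary 0 p + bary 1 p + bary 2 p = 1 := by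
  simp [bary]; ring

lemma bary_nonneg (i : Fin 3) {p : Plane} (hp : p ∈ gasket) : 0 ≤ bary i p := by
  -- a minimum `c` over the compact gasket satisfies `c ≥ c / 2` by self-similarity
  obtain ⟨p₀, hp₀, hmin⟩ := isCompact_gasket.exists_isMinOn gasket_nonempty
    (continuous_bary i).continuousOn
  rw [isMinOn_iff] at hmin
  have h0 := hp₀
  rw [gasket_eq] at h0
  obtain ⟨j, p₁, hp₁, rfl⟩ := Set.mem_iUnion.1 h0
  have h1 := hmin p₁ hp₁
  have h2 := hmin p hp
  rw [bary_F] at h1 h2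
  split_ifs at h1 h2 <;> linarith

lemma bary_le_one (i : Fin 3) {p : Plane} (hp : p ∈ gasket) : bary i p ≤ 1 := by
  have := bary_sum p
  have h0 := bary_nonneg 0 hp
  have h1 := bary_nonneg 1 hp
  have h2 := bary_nonneg 2 hp
  fin_cases i <;> simp <;> linarith

lemma bary_ext {p p' : Plane} (h : ∀ i, bary i p = bary i p') : p = p' := by
  have h3 : 0 < √3 := by positivity
  have h0 := h 0
  have h1 := h 2
  simp only [bary, Matrix.cons_val] at h0 h1
  have h2 : √3 * p 0 = √3 * p' 0 := by linarith
  ext i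
  fin_cases i
  · exact mul_left_cancel₀ h3.ne' h2
  · exact h0

lemma bary_q (i j : Fin 3) : bary i (q j) = if i = j then 1 else 0 := by
  have h1 := bary_F i j (q j)
  rw [F_q] at h1
  linarith

lemma q_injective : Function.Injective q := by
  intro i j h
  by_contra hij
  have h1 := bary_q i j
  rw [← h, bary_q] at h1
  simp [hij] at h1

lemma eq_q_of_bary_eq_one {i : Fin 3} {p : Plane} (hp : p ∈ gasket) (h : bary i p = 1) :
    p = q i := by
  have := bary_sum p
  have h0 := bary_nonneg 0 hp
  have h1 := bary_nonneg 1 hp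
  have h2 := bary_nonneg 2 hp
  refine bary_ext fun j => ?_
  rw [bary_q]
  fin_cases i <;> fin_cases j <;> simp at h ⊢ <;> linarith

/-- Two different cells of level one meet in a single point. -/
lemma eq_q_of_F_eq {i j : Fin 3} (hij : i ≠ j) {p p' : Plane} (hp : p ∈ gasket)
    (hp' : p' ∈ gasket) (h : F i p = F j p') : p = q j ∧ p' = q i := by
  have h1 := bary_F i i p
  have h2 := bary_F j i p
  rw [h, bary_F] at h1 h2
  simp only [hij, hij.symm, if_true, if_false] at h1 h2
  have := bary_nonneg i hp
  have := bary_le_one i hp'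
  have := bary_le_one j hp
  have := bary_nonneg j hp'
  exact ⟨eq_q_of_bary_eq_one hp (by linarith), eq_q_of_bary_eq_one hp' (by linarith)⟩

lemma eq_replicate_of_cell_eq_q {l : List (Fin 3)} {p : Plane} (hp : p ∈ gasket) {i : Fin 3}
    (h : cell l p = q i) : l = List.replicate l.length i ∧ p = q i := by
  induction l with
  | nil => exact ⟨rfl, h⟩
  | cons j l ih =>
    have hj : j = i := by
      by_contra hj
      have h1 : F j (cell l p) = F i (q i) := by rw [F_q]; exact h
      have h2 := (eq_q_of_F_eq hj (cell_mem l hp) (q_mem i) h1).2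
      exact hj (q_injective h2).symm
    subst hj
    have h1 : F j (cell l p) = F j (q j) := by rw [F_q]; exact h
    obtain ⟨h2, h3⟩ := ih (F_injective j h1)
    refine ⟨?_, h3⟩
    rw [List.length_cons, List.replicate_succ, ← h2]

/-- Two different cells of the same level meet at most in a common corner. -/
lemma eq_q_of_cell_eq {l l' : List (Fin 3)} (hl : l.length = l'.length) (hne : l ≠ l')
    {p p' : Plane} (hp : p ∈ gasket) (hp' : p' ∈ gasket) (h : cell l p = cell l' p') :
    ∃ a, p = q a := by
  induction l generalizing l' with
  | nil => exact absurd (List.length_eq_zero_iff.1 hl.symm).symm hne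
  | cons i l ih =>
    obtain _ | ⟨j, l'⟩ := l'
    · simp at hl
    · by_cases hij : i = j
      · subst hij
        exact ih (by simpa using hl) (by simpa using hne) (F_injective i h)
      · have h1 := (eq_q_of_F_eq hij (cell_mem l hp) (cell_mem l' hp') h).1
        exact ⟨j, (eq_replicate_of_cell_eq_q hp h1).2⟩

/-- A junction point is a corner of exactly two cells of a given level. -/
lemma eq_of_cell_eq_junction {v : List (Fin 3)} {i j : Fin 3} (hij : i ≠ j) {k : ℕ}
    {l : List (Fin 3)} {a : Fin 3} (hl : l.length = v.length + 1 + k)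
    (h : cell l (q a) = cell (v ++ i :: List.replicate k j) (q j)) :
    (l = v ++ i :: List.replicate k j ∧ a = j) ∨ (l = v ++ j :: List.replicate k i ∧ a = i) := by
  induction v generalizing l with
  | nil =>
    obtain _ | ⟨c, l⟩ := l
    · simp at hl; omega
    have hk : l.length = k := by simp at hl; omega
    simp only [List.nil_append, cell, Function.comp_apply, cell_replicate] at h
    by_cases hc : c = i
    · subst hc
      obtain ⟨h1, h2⟩ := eq_replicate_of_cell_eq_q (q_mem a) (F_injective c h)
      left
      rw [hk] at h1
      exact ⟨by rw [h1]; rfl, q_injective h2⟩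
    · obtain ⟨h1, h2⟩ := eq_q_of_F_eq hc (cell_mem l (q_mem a)) (q_mem j) h
      have h3 := q_injective h2
      subst h3
      obtain ⟨h1, h2⟩ := eq_replicate_of_cell_eq_q (q_mem a) h1
      right
      rw [hk] at h1
      exact ⟨by rw [h1]; rfl, q_injective h2⟩
  | cons b v ih =>
    obtain _ | ⟨c, l⟩ := l
    · simp at hl; omega
    by_cases hc : c = b
    · subst hc
      have := ih (l := l) (by simp at hl; omega) (F_injective c h)
      simpa using this
    · exfalso
      obtain ⟨-, h2⟩ := eq_q_of_F_eq hc (cell_mem l (q_mem a)) (cell_mem _ (q_mem j)) h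
      obtain ⟨h3, h4⟩ := eq_replicate_of_cell_eq_q (q_mem j) h2
      have h5 : i ∈ v ++ i :: List.replicate k j := by simp
      rw [show v ++ i :: List.replicate k j = _ from h3] at h5
      exact hij ((List.eq_of_mem_replicate h5).trans (q_injective h4).symm)

lemma junction_notMem_vertices_zero {v : List (Fin 3)} {i j : Fin 3} (hij : i ≠ j) (k : ℕ) :
    cell (v ++ i :: List.replicate k j) (q j) ∉ vertices 0 := by
  intro h
  simp only [vertices, Finset.mem_image, Finset.mem_univ, true_and, wordMap] at h
  obtain ⟨⟨w, a⟩, h⟩ := h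
  obtain ⟨h3, h4⟩ := eq_replicate_of_cell_eq_q (q_mem j) h.symm
  have h5 : i ∈ v ++ i :: List.replicate k j := by simp
  rw [h3] at h5
  exact hij ((List.eq_of_mem_replicate h5).trans (q_injective h4).symm)

lemma cell_mem_vertices {m : ℕ} {l : List (Fin 3)} (hl : l.length = m) (i : Fin 3) :
    cell l (q i) ∈ vertices m := by
  obtain ⟨w, rfl⟩ := exists_ofFn hl
  simp only [vertices, Finset.mem_image, Finset.mem_univ, true_and]
  exact ⟨(w, i), by rw [wordMap_eq_cell]⟩

/-! ### The graph Laplacian at a junction point -/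

/-- The (not renormalized) normal derivative of `u` at the corner `j` of the cell `l`. -/
noncomputable def normalDeriv (u : Plane → ℝ) (l : List (Fin 3)) (j : Fin 3) : ℝ :=
  ∑ a, (u (cell l (q j)) - u (cell l (q a)))

/-- The graph Laplacian of level `v.length + 1 + k` at the junction point `F_v F_i q_j`. -/
noncomputable def junctionLaplacian (u : Plane → ℝ) (v : List (Fin 3)) (i j : Fin 3) (k : ℕ) : ℝ :=
  -(normalDeriv u (v ++ i :: List.replicate k j) j + normalDeriv u (v ++ j :: List.replicate k i) i)

lemma adj_iff {m : ℕ} {z z' : Plane} : Adj m z z' ↔ ∃ (l : List (Fin 3)) (i j : Fin 3),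
    l.length = m ∧ i ≠ j ∧ z = cell l (q i) ∧ z' = cell l (q j) := by
  constructor
  · rintro ⟨w, i, j, h, h1, h2⟩
    rw [wordMap_eq_cell] at h1 h2
    exact ⟨_, i, j, by simp, h, h1, h2⟩
  · rintro ⟨l, i, j, hl, h, h1, h2⟩
    obtain ⟨w, rfl⟩ := exists_ofFn hl
    exact ⟨w, i, j, h, by rw [wordMap_eq_cell, h1], by rw [wordMap_eq_cell, h2]⟩

lemma graphLaplacian_junction (u : Plane → ℝ) (v : List (Fin 3)) {i j : Fin 3} (hij : i ≠ j)
    (k : ℕ) :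
    graphLaplacian (v.length + 1 + k) u (cell (v ++ i :: List.replicate k j) (q j))
      = junctionLaplacian u v i j k := by
  classical
  set w₁ := v ++ i :: List.replicate k j with hw₁
  set w₂ := v ++ j :: List.replicate k i with hw₂
  set z := cell w₁ (q j) with hz
  have hz2 : z = cell w₂ (q i) := cell_junction v i j k
  have hl₁ : w₁.length = v.length + 1 + k := by simp [hw₁]; omega
  have hl₂ : w₂.length = v.length + 1 + k := by simp [hw₂]; omega
  have hset : (vertices (v.length + 1 + k)).filter (Adj (v.length + 1 + k) z)
      = (Finset.univ.erase j).image (fun a => cell w₁ (q a))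
        ∪ (Finset.univ.erase i).image (fun a => cell w₂ (q a)) := by
    ext y
    simp only [Finset.mem_filter, Finset.mem_union, Finset.mem_image, Finset.mem_erase,
      Finset.mem_univ, and_true, adj_iff]
    constructor
    · rintro ⟨-, l, a, b, hl, hab, h1, rfl⟩
      rcases eq_of_cell_eq_junction hij hl h1.symm with ⟨rfl, rfl⟩ | ⟨rfl, rfl⟩
      · exact Or.inl ⟨b, hab.symm, rfl⟩
      · exact Or.inr ⟨b, hab.symm, rfl⟩
    · rintro (⟨b, hb, rfl⟩ | ⟨b, hb, rfl⟩)
      · exact ⟨cell_mem_vertices hl₁ b, w₁, j, b, hl₁, hb.symm, rfl, rfl⟩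
      · exact ⟨cell_mem_vertices hl₂ b, w₂, i, b, hl₂, hb.symm, hz2, rfl⟩
  have hdisj : Disjoint ((Finset.univ.erase j).image (fun a => cell w₁ (q a)))
      ((Finset.univ.erase i).image (fun a => cell w₂ (q a))) := by
    rw [Finset.disjoint_left]
    simp only [Finset.mem_image, Finset.mem_erase, Finset.mem_univ, and_true]
    rintro y ⟨a, ha, rfl⟩ ⟨b, hb, h⟩
    simp only [hw₁, hw₂, cell_append] at h
    have h1 := cell_injective v h
    have h2 := (eq_q_of_F_eq hij.symm (cell_mem _ (q_mem b)) (cell_mem _ (q_mem a)) h1).2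
    exact ha (q_injective (eq_replicate_of_cell_eq_q (q_mem a) h2).2)
  have hinj : ∀ w, Function.Injective fun a => cell w (q a) :=
    fun w => (cell_injective w).comp q_injective
  rw [graphLaplacian]
  convert_to ∑ z' ∈ (vertices (v.length + 1 + k)).filter (Adj (v.length + 1 + k) z),
    (u z' - u z) = _
  rw [hset, Finset.sum_union hdisj, Finset.sum_image fun _ _ _ _ h => hinj w₁ h,
    Finset.sum_image fun _ _ _ _ h => hinj w₂ h, junctionLaplacian, normalDeriv, normalDeriv,
    ← Finset.add_sum_erase _ _ (Finset.mem_univ j),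
    ← Finset.add_sum_erase (a := i) _ _ (Finset.mem_univ i), neg_add, ← hw₁, ← hw₂, ← hz2, ← hz,
    sub_self, zero_add, zero_add, ← Finset.sum_neg_distrib, ← Finset.sum_neg_distrib]
  simp

/-! ### Functions with vanishing Laplacian are graph harmonic -/

lemma sum_eq_three {j a b : Fin 3} (hja : j ≠ a) (hjb : j ≠ b) (hab : a ≠ b) (f : Fin 3 → ℝ) :
    ∑ i, f i = f j + f a + f b := by
  have h : (Finset.univ : Finset (Fin 3)) = {j, a, b} := by
    revert j a b; decide
  rw [h, Finset.sum_insert (by simp [hja, hjb]), Finset.sum_insert (by simpa using hab),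
    Finset.sum_singleton, add_assoc]

lemma exists_third (i j : Fin 3) : ∃ c, c ≠ i ∧ c ≠ j := by
  revert i j; decide

lemma junctionLaplacian_comm (u : Plane → ℝ) (v : List (Fin 3)) (i j : Fin 3) (k : ℕ) :
    junctionLaplacian u v i j k = junctionLaplacian u v j i k := by
  rw [junctionLaplacian, junctionLaplacian, add_comm]

lemma cell_append_singleton_q_comm (l : List (Fin 3)) (i j : Fin 3) :
    cell (l ++ [i]) (q j) = cell (l ++ [j]) (q i) := by
  simp [cell_append, cell, F_q_comm i j]

lemma cell_append_singleton_q_self (l : List (Fin 3)) (i : Fin 3) :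
    cell (l ++ [i]) (q i) = cell l (q i) := by
  simp [cell_append, cell, F_q]

/-- Refinement of the normal derivative by one level: the correction is a combination of the graph
Laplacians at the three midpoints of the cell, with the values `2/5, 2/5, 1/5` at the midpoints of
the harmonic function that is `1` at the corner `j` and `0` at the two others. -/
lemma normalDeriv_refine (u : Plane → ℝ) (l : List (Fin 3)) {j a b : Fin 3} (hja : j ≠ a)
    (hjb : j ≠ b) (hab : a ≠ b) :
    normalDeriv u l j = 5 / 3 * (normalDeriv u (l ++ [j]) j
      - 2 / 5 * (junctionLaplacian u l j a 0 + junctionLaplacian u l j b 0)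
      - 1 / 5 * junctionLaplacian u l a b 0) := by
  simp only [junctionLaplacian, normalDeriv, List.replicate_zero, sum_eq_three hja hjb hab,
    cell_append_singleton_q_self, cell_append_singleton_q_comm l a j,
    cell_append_singleton_q_comm l b j, cell_append_singleton_q_comm l b a]
  ring

lemma junctionLaplacian_refine (u : Plane → ℝ) (v : List (Fin 3)) {i j c : Fin 3} (hij : i ≠ j)
    (hi : c ≠ i) (hj : c ≠ j) (k : ℕ) :
    junctionLaplacian u v i j k = 5 / 3 * (junctionLaplacian u v i j (k + 1)
      + 2 / 5 * (junctionLaplacian u (v ++ i :: List.replicate k j) j i 0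
        + junctionLaplacian u (v ++ i :: List.replicate k j) j c 0)
      + 1 / 5 * junctionLaplacian u (v ++ i :: List.replicate k j) i c 0
      + 2 / 5 * (junctionLaplacian u (v ++ j :: List.replicate k i) i j 0
        + junctionLaplacian u (v ++ j :: List.replicate k i) i c 0)
      + 1 / 5 * junctionLaplacian u (v ++ j :: List.replicate k i) j c 0) := by
  rw [junctionLaplacian, normalDeriv_refine u _ hij.symm hj.symm hi.symm,
    normalDeriv_refine u (v ++ j :: List.replicate k i) hij hi.symm hj.symm,
    junctionLaplacian.eq_1 u v i j (k + 1), List.replicate_succ', List.replicate_succ']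
  simp only [List.append_assoc, List.cons_append]
  ring

/-- The weights in `junctionLaplacian_refine` add up to `5`, so that a bound for the graph Laplacian
of level `m` gives one for the graph Laplacians of lower levels. -/
lemma abs_junctionLaplacian_le {u : Plane → ℝ} {K : Set Plane} {m : ℕ} {δ : ℝ}
    (hK : ∀ z ∈ K, z ∈ vertices m → z ∉ vertices 0 → |graphLaplacian m u z| ≤ δ) (d : ℕ)
    {v : List (Fin 3)} {i j : Fin 3} {k : ℕ} (hij : i ≠ j) (hm : v.length + 1 + k + d = m)
    (h₁ : cell (v ++ i :: List.replicate k j) '' gasket ⊆ K)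
    (h₂ : cell (v ++ j :: List.replicate k i) '' gasket ⊆ K) :
    |junctionLaplacian u v i j k| ≤ 5 ^ d * δ := by
  induction d generalizing v i j k with
  | zero =>
    obtain rfl : v.length + 1 + k = m := hm
    rw [← graphLaplacian_junction u v hij, pow_zero, one_mul]
    refine hK _ (h₁ ⟨_, q_mem j, rfl⟩) (cell_mem_vertices ?_ j) (junction_notMem_vertices_zero hij k)
    simp; omega
  | succ d ih =>
    obtain ⟨c, hi, hj⟩ := exists_third i j
    have hsub : ∀ w : List (Fin 3), cell w '' gasket ⊆ K → w.length = v.length + 1 + k →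
        ∀ a b : Fin 3, a ≠ b → |junctionLaplacian u w a b 0| ≤ 5 ^ d * δ := by
      intro w hw hl a b hab
      exact ih hab (by omega) ((cell_append_subset _ _).trans hw)
        ((cell_append_subset _ _).trans hw)
    have e₁ := hsub _ h₁ (by simp; omega)
    have e₂ := hsub _ h₂ (by simp; omega)
    have e₀ : |junctionLaplacian u v i j (k + 1)| ≤ 5 ^ d * δ := by
      refine ih hij (by omega) ?_ ?_
      · rw [List.replicate_succ', ← List.cons_append, ← List.append_assoc]
        exact (cell_append_subset _ _).trans h₁
      · rw [List.replicate_succ', ← List.cons_append, ← List.append_assoc]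
        exact (cell_append_subset _ _).trans h₂
    rw [junctionLaplacian_refine u v hij hi hj k, pow_succ]
    have a0 := abs_le.1 e₀
    have a1 := abs_le.1 (e₁ j i hij.symm)
    have a2 := abs_le.1 (e₁ j c hj.symm)
    have a3 := abs_le.1 (e₁ i c hi.symm)
    have a4 := abs_le.1 (e₂ i j hij)
    have a5 := abs_le.1 (e₂ i c hi.symm)
    have a6 := abs_le.1 (e₂ j c hj.symm)
    rw [abs_le]
    constructor <;> linarith

lemma junctionLaplacian_eq_zero_of_hasLaplacianOn {u : Plane → ℝ} {U : Set Plane}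
    (hu : HasLaplacianOn u 0 U) {v : List (Fin 3)} {i j : Fin 3} {k : ℕ} (hij : i ≠ j)
    (h₁ : cell (v ++ i :: List.replicate k j) '' gasket ⊆ U)
    (h₂ : cell (v ++ j :: List.replicate k i) '' gasket ⊆ U) :
    junctionLaplacian u v i j k = 0 := by
  refine abs_eq_zero.1 (le_antisymm (le_of_forall_pos_le_add fun ε hε => ?_) (abs_nonneg _))
  obtain ⟨M, hM⟩ := hu.2.2 _ (Set.union_subset h₁ h₂) ((isCompact_cell _).union (isCompact_cell _))
    ε hε
  refine (abs_junctionLaplacian_le (u := u) (δ := ε / 5 ^ (v.length + 1 + k + M))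
    (fun z hz hz1 hz2 => ?_) M hij rfl Set.subset_union_left Set.subset_union_right).trans ?_
  rotate_left
  · rw [zero_add, mul_div_assoc', div_le_iff₀ (by positivity), mul_comm]
    gcongr
    · norm_num
    · omega
  · have h := hM (v.length + 1 + k + M) (by omega) z hz hz1 hz2
    rw [Pi.zero_apply, sub_zero, abs_mul, abs_of_pos (by positivity)] at h
    rw [le_div_iff₀ (by positivity)]
    have h5 : (0 : ℝ) < 5 ^ (v.length + 1 + k + M) := by positivity
    nlinarith [abs_nonneg (graphLaplacian (v.length + 1 + k + M) u z)]

lemma q_notMem_cell {l : List (Fin 3)} {a b : Fin 3} (h : b ∈ l) (hab : b ≠ a) :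
    q a ∉ cell l '' gasket := by
  rintro ⟨p, hp, h1⟩
  rw [(eq_replicate_of_cell_eq_q hp h1).1] at h
  exact hab (List.eq_of_mem_replicate h)

/-! ### The corner `q 0` is removable -/

section Apex

variable {u : Plane → ℝ} {A : Set Plane}

lemma junctionLaplacian_eq_zero_of_mem (hu : HasLaplacianOn u 0 (A \ {q 0})) {v : List (Fin 3)}
    {i j : Fin 3} {k : ℕ} (hij : i ≠ j) {a b : Fin 3}
    (ha : a ∈ v ++ i :: List.replicate k j) (ha0 : a ≠ 0)
    (hb : b ∈ v ++ j :: List.replicate k i) (hb0 : b ≠ 0)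
    (h₁ : cell (v ++ i :: List.replicate k j) '' gasket ⊆ A)
    (h₂ : cell (v ++ j :: List.replicate k i) '' gasket ⊆ A) :
    junctionLaplacian u v i j k = 0 :=
  junctionLaplacian_eq_zero_of_hasLaplacianOn hu hij
    (Set.subset_sdiff_singleton h₁ (q_notMem_cell ha ha0))
    (Set.subset_sdiff_singleton h₂ (q_notMem_cell hb hb0))

lemma apexLaplacian_refine (hu : HasLaplacianOn u 0 (A \ {q 0})) {N : ℕ} {i c : Fin 3}
    (hi : i ≠ 0) (hci : c ≠ i) (hc : c ≠ 0)
    (h₁ : cell (List.replicate N 0 ++ [0]) '' gasket ⊆ A)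
    (h₂ : cell (List.replicate N 0 ++ [i]) '' gasket ⊆ A) :
    junctionLaplacian u (List.replicate N 0) 0 i 0 =
      2 / 3 * junctionLaplacian u (List.replicate (N + 1) 0) 0 i 0
      + 1 / 3 * junctionLaplacian u (List.replicate (N + 1) 0) 0 c 0 := by
  have s₁ : ∀ s, cell ((List.replicate N 0 ++ [0]) ++ s) '' gasket ⊆ A :=
    fun s => (cell_append_subset _ _).trans h₁
  have s₂ : ∀ s, cell ((List.replicate N 0 ++ [i]) ++ s) '' gasket ⊆ A :=
    fun s => (cell_append_subset _ _).trans h₂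
  have e0 : junctionLaplacian u (List.replicate N 0) 0 i 1 = 0 :=
    junctionLaplacian_eq_zero_of_mem hu hi.symm (a := i) (b := i) (by simp) hi (by simp) hi
      (by simpa using s₁ [i]) (by simpa using s₂ [0])
  have e1 : junctionLaplacian u (List.replicate N 0 ++ [0]) i c 0 = 0 :=
    junctionLaplacian_eq_zero_of_mem hu hci.symm (a := i) (b := c) (by simp) hi (by simp) hc
      (s₁ _) (s₁ _)
  have e2 : ∀ a b, a ≠ b → junctionLaplacian u (List.replicate N 0 ++ [i]) a b 0 = 0 :=
    fun a b hab => junctionLaplacian_eq_zero_of_mem hu hab (a := i) (b := i) (by simp) hi (by simp)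
      hi (s₂ _) (s₂ _)
  rw [junctionLaplacian_refine u _ hi.symm hc hci 0]
  simp only [List.replicate_zero, zero_add]
  rw [e0, e1, e2 0 i hi.symm, e2 0 c hc.symm, e2 i c hci.symm, ← List.replicate_succ',
    junctionLaplacian_comm u _ i 0]
  ring

lemma tendsto_cell_replicate (p : Plane) :
    Tendsto (fun N => cell (List.replicate N 0) p) atTop (𝓝 (q 0)) := by
  have h1 : ∀ N, cell (List.replicate N 0) p = q 0 + (1 / 2 : ℝ) ^ N • (p - q 0) := by
    intro N
    rw [← iterate_F]
    induction N with
    | zero => rfl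
    | succ N ih =>
      rw [List.replicate_succ, cell, Function.comp_apply, ih, Function.iterate_succ_apply']
  simp_rw [h1]
  have := ((tendsto_pow_atTop_nhds_zero_of_lt_one (r := (1 / 2 : ℝ)) (by norm_num)
      (by norm_num)).smul_const (p - q 0)).const_add (q 0)
  simpa using this

lemma tendsto_normalDeriv_apex (hc : ContinuousOn u A) {N₀ : ℕ}
    (hA : cell (List.replicate N₀ 0) '' gasket ⊆ A) (s : List (Fin 3)) (j : Fin 3) :
    Tendsto (fun N => normalDeriv u (List.replicate N 0 ++ s) j) atTop (𝓝 0) := by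
  have h0 : q 0 ∈ A := hA ⟨q 0, q_mem 0, cell_replicate N₀ 0⟩
  have h1 : ∀ a, Tendsto (fun N => u (cell (List.replicate N 0 ++ s) (q a))) atTop
      (𝓝 (u (q 0))) := by
    intro a
    refine (hc _ h0).tendsto.comp (tendsto_nhdsWithin_iff.2 ⟨?_, ?_⟩)
    · simp_rw [cell_append]
      exact tendsto_cell_replicate _
    · filter_upwards [eventually_ge_atTop N₀] with N hN
      obtain ⟨d, rfl⟩ := Nat.exists_eq_add_of_le hN
      rw [List.replicate_add, List.append_assoc]
      exact hA (cell_append_subset _ _ ⟨_, q_mem a, rfl⟩)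
  have h2 := tendsto_finsetSum Finset.univ fun a _ => (h1 j).sub (h1 a)
  simpa [normalDeriv] using h2

/-- The sum of the absolute values of the graph Laplacians of level `N + 1` at the two neighbours of
`q 0` does not decrease with `N`, by `apexLaplacian_refine`, and it tends to `0` by continuity. -/
lemma apexLaplacian_eq_zero (hu : HasLaplacianOn u 0 (A \ {q 0})) (hc : ContinuousOn u A) {N : ℕ}
    (hA : cell (List.replicate N 0) '' gasket ⊆ A) {i : Fin 3} (hi : i ≠ 0) :
    junctionLaplacian u (List.replicate N 0) 0 i 0 = 0 := by
  set D : ℕ → Fin 3 → ℝ := fun M i => junctionLaplacian u (List.replicate M 0) 0 i 0 with hD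
  have hsub : ∀ M, N ≤ M → ∀ s, cell (List.replicate M 0 ++ s) '' gasket ⊆ A := by
    intro M hM s
    obtain ⟨d, rfl⟩ := Nat.exists_eq_add_of_le hM
    rw [List.replicate_add, List.append_assoc]
    exact (cell_append_subset _ _).trans hA
  have hstep : ∀ M, N ≤ M → |D M 1| + |D M 2| ≤ |D (M + 1) 1| + |D (M + 1) 2| := by
    intro M hM
    have e1 : D M 1 = 2 / 3 * D (M + 1) 1 + 1 / 3 * D (M + 1) 2 :=
      apexLaplacian_refine hu (by decide) (by decide) (by decide) (hsub M hM _) (hsub M hM _)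
    have e2 : D M 2 = 2 / 3 * D (M + 1) 2 + 1 / 3 * D (M + 1) 1 :=
      apexLaplacian_refine hu (by decide) (by decide) (by decide) (hsub M hM _) (hsub M hM _)
    have a1 := abs_add_le (2 / 3 * D (M + 1) 1) (1 / 3 * D (M + 1) 2)
    have a2 := abs_add_le (2 / 3 * D (M + 1) 2) (1 / 3 * D (M + 1) 1)
    have p1 : |(2 / 3 : ℝ)| = 2 / 3 := abs_of_pos (by norm_num)
    have p2 : |(1 / 3 : ℝ)| = 1 / 3 := abs_of_pos (by norm_num)
    rw [← e1, abs_mul, abs_mul, p1, p2] at a1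
    rw [← e2, abs_mul, abs_mul, p1, p2] at a2
    linarith
  have hmono : ∀ M, N ≤ M → |D N 1| + |D N 2| ≤ |D M 1| + |D M 2| := by
    intro M hM
    induction M, hM using Nat.le_induction with
    | base => exact le_rfl
    | succ M hM ih => exact ih.trans (hstep M hM)
  have hlim : ∀ i, Tendsto (fun M => |D M i|) atTop (𝓝 0) := by
    intro i
    have := ((tendsto_normalDeriv_apex hc hA [0] i).add
      (tendsto_normalDeriv_apex hc hA [i] 0)).neg.abs
    simpa [hD, junctionLaplacian] using this
  have h0 : |D N 1| + |D N 2| ≤ 0 + 0 :=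
    ge_of_tendsto ((hlim 1).add (hlim 2)) ((eventually_ge_atTop N).mono hmono)
  have h1 := abs_nonneg (D N 1)
  have h2 := abs_nonneg (D N 2)
  fin_cases i
  · exact absurd rfl hi
  · exact abs_eq_zero.1 (show |D N 1| = 0 by linarith)
  · exact abs_eq_zero.1 (show |D N 2| = 0 by linarith)

/-- A continuous function on `A` with vanishing Laplacian away from `q 0` is graph harmonic at all
junction points whose two adjacent cells lie in `A`, also where `q 0` is a corner of one of
these cells. -/
lemma junctionLaplacian_eq_zero (hu : HasLaplacianOn u 0 (A \ {q 0})) (hc : ContinuousOn u A)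
    {v : List (Fin 3)} {i j : Fin 3} {k : ℕ} (hij : i ≠ j)
    (h₁ : cell (v ++ i :: List.replicate k j) '' gasket ⊆ A)
    (h₂ : cell (v ++ j :: List.replicate k i) '' gasket ⊆ A) :
    junctionLaplacian u v i j k = 0 := by
  have hapex : ∀ {i j : Fin 3}, i ≠ j → cell (v ++ i :: List.replicate k j) '' gasket ⊆ A →
      cell (v ++ j :: List.replicate k i) '' gasket ⊆ A →
      (∀ a ∈ v ++ i :: List.replicate k j, a = 0) → junctionLaplacian u v i j k = 0 := by
    intro i j hij h₁ h₂ h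
    obtain rfl : i = 0 := h i (by simp)
    obtain rfl : k = 0 := by
      by_contra hk
      exact hij (h j (by simp [hk])).symm
    have hv : v = List.replicate v.length 0 :=
      List.eq_replicate_iff.2 ⟨rfl, fun b hb => h b (by simp [hb])⟩
    rw [hv] at h₁ h₂ ⊢
    obtain ⟨c, hcj, hc0⟩ := exists_third j 0
    have hA : cell (List.replicate (v.length + 1) 0) '' gasket ⊆ A := by
      rw [List.replicate_succ']; exact h₁
    rw [apexLaplacian_refine hu hij.symm hcj hc0 h₁ h₂, apexLaplacian_eq_zero hu hc hA hij.symm,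
      apexLaplacian_eq_zero hu hc hA hc0]
    simp
  by_cases ha : ∀ a ∈ v ++ i :: List.replicate k j, a = 0
  · exact hapex hij h₁ h₂ ha
  by_cases hb : ∀ a ∈ v ++ j :: List.replicate k i, a = 0
  · rw [junctionLaplacian_comm]
    exact hapex hij.symm h₂ h₁ hb
  push Not at ha hb
  obtain ⟨a, ha, ha0⟩ := ha
  obtain ⟨b, hb, hb0⟩ := hb
  exact junctionLaplacian_eq_zero_of_mem hu hij ha ha0 hb hb0 h₁ h₂

end Apex

/-! ### Position of the cells relative to the line -/

/-- The vertical distance from `q 0` to the top vertex of the cell `l`. -/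
noncomputable def depth (l : List (Fin 3)) : ℝ := 1 - (cell l (q 0)) 1

/-- The line at distance `x` from `q 0` passes strictly between the top vertex and the bottom edge
of the cell `l`. -/
def Crosses (x : ℝ) (l : List (Fin 3)) : Prop :=
  depth l < x ∧ x < depth l + (1 / 2) ^ l.length

/-- The cell `l` lies strictly above the line at distance `x` from `q 0`. -/
def Above (x : ℝ) (l : List (Fin 3)) : Prop := depth l + (1 / 2) ^ l.length < x

lemma height_F (i : Fin 3) (p : Plane) : (F i p) 1 = (p 1 + if i = 0 then 1 else 0) / 2 := by
  have := bary_F 0 i p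
  simpa [bary, eq_comm] using this

lemma height_cell (l : List (Fin 3)) (p : Plane) :
    1 - (cell l p) 1 = depth l + (1 / 2) ^ l.length * (1 - p 1) := by
  rw [depth]
  induction l with
  | nil => simp [cell, q]
  | cons i l ih =>
    simp only [cell, Function.comp_apply, height_F, List.length_cons, pow_succ]
    linarith

lemma height_q_eq (i : Fin 3) : (q i) 1 = if i = 0 then 1 else 0 := by
  have := bary_q 0 i
  simpa [bary, eq_comm] using this

lemma depth_append_singleton (l : List (Fin 3)) (a : Fin 3) :
    depth (l ++ [a]) = depth l + if a = 0 then 0 else (1 / 2) ^ (l.length + 1) := by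
  rw [depth, cell_append, height_cell]
  simp only [cell, Function.comp_apply, id, height_F, height_q_eq]
  split_ifs <;> simp [pow_succ] <;> ring

lemma depth_append_replicate (l : List (Fin 3)) (k : ℕ) :
    depth (l ++ List.replicate k 0) = depth l := by
  rw [depth, cell_append, cell_replicate, depth]

lemma depth_le_depth_append_singleton (l : List (Fin 3)) (a : Fin 3) :
    depth l ≤ depth (l ++ [a]) := by
  rw [depth_append_singleton]
  split_ifs
  · simp
  · have : (0 : ℝ) < (1 / 2) ^ (l.length + 1) := by positivity
    linarith

lemma bottom_append_singleton_le (l : List (Fin 3)) (a : Fin 3) :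
    depth (l ++ [a]) + (1 / 2) ^ (l ++ [a]).length ≤ depth l + (1 / 2) ^ l.length := by
  have : (0 : ℝ) < (1 / 2) ^ l.length := by positivity
  rw [depth_append_singleton, List.length_append, List.length_singleton, pow_succ]
  split_ifs <;> linarith

lemma exists_height_corner (l : List (Fin 3)) (a : Fin 3) :
    ∃ j : ℕ, 1 - (cell l (q a)) 1 = j / 2 ^ l.length := by
  induction l with
  | nil =>
    refine ⟨if a = 0 then 0 else 1, ?_⟩
    simp only [cell, id, height_q_eq]
    split_ifs <;> simp
  | cons i l ih =>
    obtain ⟨j, hj⟩ := ih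
    refine ⟨j + if i = 0 then 0 else 2 ^ l.length, ?_⟩
    simp only [cell, Function.comp_apply, height_F, List.length_cons, pow_succ]
    have h2 : (0 : ℝ) < 2 ^ l.length := by positivity
    rw [eq_div_iff h2.ne'] at hj
    rw [eq_div_iff (by positivity)]
    split_ifs <;> push_cast <;> linarith

lemma exists_depth_eq (l : List (Fin 3)) : ∃ j : ℕ, depth l = j / 2 ^ l.length :=
  exists_height_corner l 0

/-- The cells of a level that the line crosses lie at the same height, since the heights of the top
vertices are multiples of `2 ^ (-k)` at level `k`. -/
lemma Crosses.depth_eq {x : ℝ} {l l' : List (Fin 3)} (h : Crosses x l) (h' : Crosses x l')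
    (hl : l.length = l'.length) : depth l = depth l' := by
  obtain ⟨j, hj⟩ := exists_depth_eq l
  obtain ⟨j', hj'⟩ := exists_depth_eq l'
  obtain ⟨h1, h2⟩ := h
  obtain ⟨h3, h4⟩ := h'
  rw [hj] at h1 h2
  rw [hj', ← hl] at h3 h4
  rw [one_div, inv_pow, ← one_div, ← add_div] at h2 h4
  have e1 := h1.trans h4
  have e2 := h3.trans h2
  have h0 : (0 : ℝ) < 2 ^ l.length := by positivity
  rw [div_lt_div_iff_of_pos_right h0] at e1 e2
  norm_cast at e1 e2
  obtain rfl : j = j' := by omega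
  rw [hj, hj', hl]

lemma Crosses.of_append_singleton {x : ℝ} {l : List (Fin 3)} {a : Fin 3}
    (h : Crosses x (l ++ [a])) : Crosses x l :=
  ⟨(depth_le_depth_append_singleton l a).trans_lt h.1,
    h.2.trans_le (bottom_append_singleton_le l a)⟩

lemma Above.append_singleton {x : ℝ} {l : List (Fin 3)} (h : Above x l) (a : Fin 3) :
    Above x (l ++ [a]) :=
  (bottom_append_singleton_le l a).trans_lt h

lemma cell_subset_iff_above {x : ℝ} (l : List (Fin 3)) :
    cell l '' gasket ⊆ Ω x ↔ Above x l := by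
  have h0 : (0 : ℝ) < (1 / 2) ^ l.length := by positivity
  constructor
  · intro h
    have h1 := (h ⟨q 1, q_mem 1, rfl⟩).2
    have h2 := height_cell l (q 1)
    rw [height_q_eq] at h2
    simp at h2
    rw [Above]
    simp
    linarith
  · rintro h _ ⟨p, hp, rfl⟩
    refine ⟨cell_mem l hp, ?_⟩
    have h1 := height_cell l p
    have h2 : 0 ≤ p 1 := bary_nonneg 0 hp
    rw [Above] at h
    nlinarith

lemma bottom_ne {x : ℝ} (hd : ∀ j k : ℕ, x ≠ j / 2 ^ k) (l : List (Fin 3)) :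
    depth l + (1 / 2) ^ l.length ≠ x := by
  obtain ⟨j, hj⟩ := exists_height_corner l 1
  rw [height_cell, height_q_eq] at hj
  simp only [one_ne_zero, if_false, sub_zero, mul_one] at hj
  rw [hj]
  exact (hd _ _).symm

/-! ### The triangles that make up the domain -/

/-- The address of the cell of the map `cellMap n m ω`. -/
def word (n : ℕ → ℕ) : (m : ℕ) → (Fin m → Fin 2) → List (Fin 3)
  | 0, _ => []
  | m + 1, ω => word n m (Fin.init ω)
      ++ (List.replicate (n (m + 1) - n m - 1) 0 ++ [(ω (Fin.last m)).succ])

/-- The address of the maximal cell above the line whose top vertex is `cellMap n m ω (q 0)`. Its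
bottom vertices are the top vertices of the two maximal cells that belong to the continuations
of `ω`. -/
def triangle (n : ℕ → ℕ) (m : ℕ) (ω : Fin m → Fin 2) : List (Fin 3) :=
  word n m ω ++ List.replicate (n (m + 1) - n m) 0

lemma cell_replicate_zero_eq_iterate (k : ℕ) : cell (List.replicate k 0) = (F 0)^[k] := by
  induction k with
  | zero => rfl
  | succ k ih => rw [List.replicate_succ, cell, ih, Function.iterate_succ']

lemma cellMap_eq_cell (n : ℕ → ℕ) (m : ℕ) (ω : Fin m → Fin 2) :
    cellMap n m ω = cell (word n m ω) := by
  induction m with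
  | zero => rfl
  | succ m ih =>
    funext p
    simp [cellMap, word, cell_append, ih, cell_replicate_zero_eq_iterate, cell]

lemma word_snoc (n : ℕ → ℕ) (m : ℕ) (ω : Fin m → Fin 2) (i : Fin 2) :
    word n (m + 1) (Fin.snoc ω i)
      = word n m ω ++ (List.replicate (n (m + 1) - n m - 1) 0 ++ [i.succ]) := by
  simp [word]

lemma word_injective (n : ℕ → ℕ) (m : ℕ) : Function.Injective (word n m) := by
  induction m with
  | zero => exact fun _ _ _ => Subsingleton.elim _ _
  | succ m ih =>
    intro ω ω' h
    rw [word, word] at h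
    obtain ⟨h1, h2⟩ := List.append_inj' h (by simp)
    obtain ⟨-, h3⟩ := List.append_inj' h2 (by simp)
    rw [← Fin.snoc_init_self ω, ← Fin.snoc_init_self ω', ih h1,
      Fin.succ_injective _ (List.singleton_inj.1 h3)]

section Expansion

variable {x : ℝ} {n : ℕ → ℕ}

lemma length_word (hx : IsBinaryExpansion x n) (m : ℕ) (ω : Fin m → Fin 2) :
    (word n m ω).length = n m := by
  induction m with
  | zero => simp [word, hx.zero]
  | succ m ih =>
    have := hx.strictMono (Nat.lt_add_one m)
    simp [word, ih]
    omega

lemma length_triangle (hx : IsBinaryExpansion x n) (m : ℕ) (ω : Fin m → Fin 2) :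
    (triangle n m ω).length = n (m + 1) := by
  have := hx.strictMono (Nat.lt_add_one m)
  simp [triangle, length_word hx]
  omega

lemma depth_word (hx : IsBinaryExpansion x n) (m : ℕ) (ω : Fin m → Fin 2) :
    depth (word n m ω) = ∑ j ∈ Finset.range m, (1 / 2 : ℝ) ^ n (j + 1) := by
  induction m with
  | zero => simp [word, depth, cell, q]
  | succ m ih =>
    have := hx.strictMono (Nat.lt_add_one m)
    rw [word, ← List.append_assoc, depth_append_singleton, depth_append_replicate, ih,
      Finset.sum_range_succ, if_neg (Fin.succ_ne_zero _)]
    congr 2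
    simp [length_word hx]
    omega

lemma partialSum_lt (hx : IsBinaryExpansion x n) (m : ℕ) :
    ∑ j ∈ Finset.range m, (1 / 2 : ℝ) ^ n (j + 1) < x := by
  have := hx.hasSum.summable.sum_le_tsum (Finset.range (m + 1)) fun _ _ => by positivity
  rw [hx.hasSum.tsum_eq, Finset.sum_range_succ] at this
  have : (0 : ℝ) < (1 / 2) ^ n (m + 1) := by positivity
  linarith

/-- The remainder of the binary expansion is strictly less than its last digit, because `x` is not
dyadic. -/
lemma lt_partialSum_add (hx : IsBinaryExpansion x n) (hd : ∀ j k : ℕ, x ≠ j / 2 ^ k) (m : ℕ) :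
    x < ∑ j ∈ Finset.range m, (1 / 2 : ℝ) ^ n (j + 1) + (1 / 2) ^ n m := by
  have hanti : Antitone fun m =>
      ∑ j ∈ Finset.range m, (1 / 2 : ℝ) ^ n (j + 1) + (1 / 2) ^ n m := by
    refine antitone_nat_of_succ_le fun m => ?_
    have h1 : (1 / 2 : ℝ) ^ n (m + 1) ≤ (1 / 2) ^ (n m + 1) :=
      pow_le_pow_of_le_one (by norm_num) (by norm_num) (hx.strictMono (Nat.lt_add_one m))
    rw [Finset.sum_range_succ]
    rw [pow_succ] at h1
    linarith
  have hlim := hx.hasSum.tendsto_sum_nat.add ((tendsto_pow_atTop_nhds_zero_of_lt_one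
    (r := (1 / 2 : ℝ)) (by norm_num) (by norm_num)).comp hx.strictMono.tendsto_atTop)
  rw [add_zero] at hlim
  refine lt_of_le_of_ne (hanti.le_of_tendsto hlim m) fun h => ?_
  have := bottom_ne hd (word n m 0)
  rw [depth_word hx, length_word hx] at this
  exact this h.symm

lemma crosses_word_append (hx : IsBinaryExpansion x n) (hd : ∀ j k : ℕ, x ≠ j / 2 ^ k) {m k : ℕ}
    (hk : n m + k < n (m + 1)) (ω : Fin m → Fin 2) :
    Crosses x (word n m ω ++ List.replicate k 0) := by
  rw [Crosses, depth_append_replicate, depth_word hx, List.length_append, List.length_replicate,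
    length_word hx]
  refine ⟨partialSum_lt hx m, ?_⟩
  have h1 := lt_partialSum_add hx hd (m + 1)
  have h2 : (1 / 2 : ℝ) ^ n (m + 1) ≤ (1 / 2) ^ (n m + k + 1) :=
    pow_le_pow_of_le_one (by norm_num) (by norm_num) hk
  rw [Finset.sum_range_succ] at h1
  rw [pow_succ] at h2
  linarith

lemma above_triangle (hx : IsBinaryExpansion x n) (m : ℕ) (ω : Fin m → Fin 2) :
    Above x (triangle n m ω) := by
  rw [Above, length_triangle hx, triangle, depth_append_replicate, depth_word hx,
    ← Finset.sum_range_succ (fun j => (1 / 2 : ℝ) ^ n (j + 1))]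
  exact partialSum_lt hx (m + 1)

lemma cell_triangle_top (m : ℕ) (ω : Fin m → Fin 2) :
    cell (triangle n m ω) (q 0) = cellMap n m ω (q 0) := by
  rw [triangle, cell_append, cell_replicate, cellMap_eq_cell]

lemma triangle_eq (hx : IsBinaryExpansion x n) (m : ℕ) (ω : Fin m → Fin 2) :
    triangle n m ω = word n m ω ++ List.replicate (n (m + 1) - n m - 1) 0 ++ [0] := by
  have := hx.strictMono (Nat.lt_add_one m)
  rw [triangle, List.append_assoc, ← List.replicate_succ']
  congr 2
  omega

lemma cell_triangle_bottom (hx : IsBinaryExpansion x n) (m : ℕ) (ω : Fin m → Fin 2) (i : Fin 2) :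
    cell (triangle n m ω) (q i.succ) = cellMap n (m + 1) (Fin.snoc ω i) (q 0) := by
  rw [triangle_eq hx, cell_append_singleton_q_comm, cellMap_eq_cell, word_snoc, List.append_assoc]

/-! ### The graph energies of a harmonic function -/

lemma sum_snoc {α : Type*} [Fintype α] (k : ℕ) (φ : (Fin (k + 1) → α) → ℝ) :
    ∑ w, φ w = ∑ w : Fin k → α, ∑ a, φ (Fin.snoc w a) := by
  rw [← (Fin.snocEquiv fun _ => α).sum_comp, Fintype.sum_prod_type, Finset.sum_comm]
  rfl

lemma ofFn_snoc (k : ℕ) (w : Fin k → Fin 3) (a : Fin 3) :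
    List.ofFn (Fin.snoc w a : Fin (k + 1) → Fin 3) = List.ofFn w ++ [a] := by
  rw [List.ofFn_succ', List.concat_eq_append]
  simp

open Classical in
/-- The cells of level `k` that the line crosses are the cells `word n m ω` followed by zeros. -/
lemma sum_crosses (hx : IsBinaryExpansion x n) (hd : ∀ j k : ℕ, x ≠ j / 2 ^ k) {m k : ℕ}
    (hm : n m ≤ k) (hk : k < n (m + 1)) (g : List (Fin 3) → ℝ) :
    ∑ w : Fin k → Fin 3, (if Crosses x (List.ofFn w) then g (List.ofFn w) else 0)
      = ∑ ω : Fin m → Fin 2, g (word n m ω ++ List.replicate (k - n m) 0) := by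
  induction k generalizing m g with
  | zero =>
    obtain rfl : m = 0 := by
      have := hx.strictMono.id_le m
      simp at this
      omega
    have h := crosses_word_append hx hd (m := 0) (k := 0) (by simpa [hx.zero] using hk) 0
    simp only [word, List.replicate_zero, List.append_nil] at h
    simp [word, h]
  | succ k ih =>
    have hstep : ∀ l : List (Fin 3),
        ∑ a, (if Crosses x (l ++ [a]) then g (l ++ [a]) else 0) = if Crosses x l then
          ∑ a, (if Crosses x (l ++ [a]) then g (l ++ [a]) else 0) else 0 := by
      intro l
      split_ifs with h
      · rfl
      · exact Finset.sum_eq_zero fun a _ => if_neg fun h' => h h'.of_append_singleton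
    rw [sum_snoc]
    simp_rw [ofFn_snoc]
    rw [Finset.sum_congr rfl fun w _ => hstep (List.ofFn w)]
    by_cases hmk : n m ≤ k
    · rw [ih hmk (by omega)
        fun l => ∑ a, (if Crosses x (l ++ [a]) then g (l ++ [a]) else 0)]
      refine Finset.sum_congr rfl fun ω _ => ?_
      have h0 := crosses_word_append hx hd (k := k + 1 - n m) (by omega) ω
      have hrep : k + 1 - n m = (k - n m) + 1 := by omega
      rw [hrep, List.replicate_succ', ← List.append_assoc] at h0 ⊢
      rw [Finset.sum_eq_single_of_mem 0 (Finset.mem_univ _), if_pos h0]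
      intro a _ ha
      refine if_neg fun h => ?_
      have h1 := h.depth_eq h0 (by simp)
      rw [depth_append_singleton, depth_append_singleton, if_neg ha] at h1
      simp at h1
    · obtain ⟨m, rfl⟩ : ∃ m', m = m' + 1 := by
        refine Nat.exists_eq_succ_of_ne_zero fun h => hmk ?_
        rw [h, hx.zero]
        exact Nat.zero_le _
      have hlt := hx.strictMono (Nat.lt_add_one m)
      have hkm : k + 1 = n (m + 1) := by omega
      rw [ih (m := m) (by omega) (by omega)
        fun l => ∑ a, (if Crosses x (l ++ [a]) then g (l ++ [a]) else 0), sum_snoc]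
      refine Finset.sum_congr rfl fun ω _ => ?_
      have hrep : n (m + 1) - n m - 1 = k - n m := by omega
      have h0 : ∀ i : Fin 2, Crosses x (word n m ω ++ List.replicate (k - n m) 0 ++ [i.succ]) := by
        intro i
        have := crosses_word_append hx hd (m := m + 1) (k := 0)
          (by simpa using hx.strictMono (Nat.lt_add_one (m + 1))) (Fin.snoc ω i)
        simpa [word_snoc, hrep] using this
      have h1 : ¬ Crosses x (word n m ω ++ List.replicate (k - n m) 0 ++ [0]) := by
        intro h
        have h1 := h.depth_eq (h0 0) (by simp)
        rw [depth_append_singleton, depth_append_singleton, if_neg (Fin.succ_ne_zero _)] at h1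
        simp at h1
      rw [Fin.sum_univ_succ, if_neg h1, zero_add]
      refine Finset.sum_congr rfl fun i _ => ?_
      rw [if_pos (h0 i), word_snoc, hrep, ← hkm]
      simp

/-- The sum of the squared differences of `u` over the edges of the cell `l`. -/
noncomputable def cellEnergy (u : Plane → ℝ) (l : List (Fin 3)) : ℝ :=
  (u (cell l (q 0)) - u (cell l (q 1))) ^ 2 + (u (cell l (q 1)) - u (cell l (q 2))) ^ 2
    + (u (cell l (q 2)) - u (cell l (q 0))) ^ 2

lemma cellEnergy_nonneg (u : Plane → ℝ) (l : List (Fin 3)) : 0 ≤ cellEnergy u l := by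
  unfold cellEnergy; positivity

open Classical in
lemma graphEnergy_eq (x : ℝ) (k : ℕ) (u : Plane → ℝ) :
    graphEnergy (Ω x) k u = (5 / 3) ^ k *
      ∑ w : Fin k → Fin 3, if Above x (List.ofFn w) then cellEnergy u (List.ofFn w) else 0 := by
  rw [graphEnergy, Finset.sum_filter]
  congr 1
  refine Finset.sum_congr rfl fun w _ => ?_
  simp only [wordMap_eq_cell, cell_subset_iff_above, cellEnergy]

/-- Refining a cell scales its unnormalized energy by `3/5`, and the new cells of level `k + 1`
above the line are the maximal cells `triangle n m ω` with `n (m + 1) = k + 1`. -/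
lemma graphEnergy_eq_sum (hx : IsBinaryExpansion x n) (hd : ∀ j k : ℕ, x ≠ j / 2 ^ k)
    {u : Plane → ℝ}
    (hu : ∀ l, Above x l → ∑ a, cellEnergy u (l ++ [a]) = 3 / 5 * cellEnergy u l) {m k : ℕ}
    (hm : n m ≤ k) (hk : k < n (m + 1)) :
    graphEnergy (Ω x) k u = ∑ j ∈ Finset.range m,
      (5 / 3) ^ n (j + 1) * ∑ ω : Fin j → Fin 2, cellEnergy u (triangle n j ω) := by
  classical
  induction k generalizing m with
  | zero =>
    obtain rfl : m = 0 := by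
      have := hx.strictMono.id_le m
      simp at this
      omega
    have h1 := (crosses_word_append hx hd (m := 0) (k := 0) (by simpa [hx.zero] using hk) 0).2
    simp only [word, List.replicate_zero, List.append_nil] at h1
    have h2 : ¬ Above x [] := fun h => lt_asymm h h1
    rw [graphEnergy_eq]
    simp [h2]
  | succ k ih =>
    have hstep : ∀ l : List (Fin 3),
        ∑ a, (if Above x (l ++ [a]) then cellEnergy u (l ++ [a]) else 0) =
          3 / 5 * (if Above x l then cellEnergy u l else 0) + if Crosses x l then
          (if Above x (l ++ [0]) then cellEnergy u (l ++ [0]) else 0) else 0 := by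
      intro l
      by_cases h : Above x l
      · have h1 : ¬ Crosses x l := fun h' => lt_asymm h h'.2
        simp only [h.append_singleton, h, h1, if_true, if_false, add_zero]
        exact hu l h
      · rw [if_neg h, mul_zero, zero_add]
        have h1 : x < depth l + (1 / 2) ^ l.length :=
          lt_of_le_of_ne (not_lt.1 h) (bottom_ne hd l).symm
        split_ifs with h2 h3
        -- the bottom cells reach down to the bottom of `l`
        · rw [Finset.sum_eq_single_of_mem 0 (Finset.mem_univ _), if_pos h3]
          intro a _ ha
          refine if_neg fun h' => ?_
          rw [Above, depth_append_singleton, if_neg ha, List.length_append, List.length_singleton,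
            pow_succ] at h'
          linarith
        · rw [Finset.sum_eq_single_of_mem 0 (Finset.mem_univ _), if_neg h3]
          intro a _ ha
          refine if_neg fun h' => ?_
          rw [Above, depth_append_singleton, if_neg ha, List.length_append, List.length_singleton,
            pow_succ] at h'
          linarith
        · refine Finset.sum_eq_zero fun a _ => if_neg fun h' => h2 ⟨?_, h1⟩
          have h3 : (0 : ℝ) < (1 / 2) ^ (l ++ [a]).length := by positivity
          have h4 := depth_le_depth_append_singleton l a
          rw [Above] at h'
          linarith
    have hrec : ∀ j, n j ≤ k → k < n (j + 1) → graphEnergy (Ω x) (k + 1) u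
        = graphEnergy (Ω x) k u + (5 / 3) ^ (k + 1) * ∑ ω : Fin j → Fin 2,
          (if Above x (word n j ω ++ List.replicate (k - n j) 0 ++ [0])
            then cellEnergy u (word n j ω ++ List.replicate (k - n j) 0 ++ [0]) else 0) := by
      intro j hj hj'
      rw [graphEnergy_eq, sum_snoc]
      simp_rw [ofFn_snoc, hstep]
      rw [Finset.sum_add_distrib, sum_crosses hx hd hj hj'
        fun l => if Above x (l ++ [0]) then cellEnergy u (l ++ [0]) else 0, ← Finset.mul_sum,
        graphEnergy_eq, pow_succ]
      ring
    by_cases hmk : n m ≤ k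
    · rw [hrec m hmk (by omega), ih hmk (by omega), add_eq_left]
      refine mul_eq_zero_of_right _ (Finset.sum_eq_zero fun ω _ => if_neg fun h => ?_)
      have h0 := crosses_word_append hx hd (k := k + 1 - n m) (by omega) ω
      have hrep : k + 1 - n m = (k - n m) + 1 := by omega
      rw [hrep, List.replicate_succ', ← List.append_assoc] at h0
      exact lt_asymm h h0.2
    · obtain ⟨m, rfl⟩ : ∃ m', m = m' + 1 := by
        refine Nat.exists_eq_succ_of_ne_zero fun h => hmk ?_
        rw [h, hx.zero]
        exact Nat.zero_le _
      have hlt := hx.strictMono (Nat.lt_add_one m)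
      have hkm : k + 1 = n (m + 1) := by omega
      rw [hrec m (by omega) (by omega), ih (m := m) (by omega) (by omega), Finset.sum_range_succ,
        hkm]
      congr 2
      refine Finset.sum_congr rfl fun ω _ => ?_
      have hrep : n (m + 1) - n m - 1 = k - n m := by omega
      have ht := triangle_eq hx m ω
      rw [hrep] at ht
      rw [← ht, if_pos (above_triangle hx m ω)]

lemma energy_eq_tsum (hx : IsBinaryExpansion x n) (hd : ∀ j k : ℕ, x ≠ j / 2 ^ k)
    {u : Plane → ℝ}
    (hu : ∀ l, Above x l → ∑ a, cellEnergy u (l ++ [a]) = 3 / 5 * cellEnergy u l) :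
    energy (Ω x) u = ∑' j, ENNReal.ofReal
      ((5 / 3) ^ n (j + 1) * ∑ ω : Fin j → Fin 2, cellEnergy u (triangle n j ω)) := by
  have hnn : ∀ j, 0 ≤ (5 / 3 : ℝ) ^ n (j + 1) *
      ∑ ω : Fin j → Fin 2, cellEnergy u (triangle n j ω) := fun j =>
    mul_nonneg (by positivity) (Finset.sum_nonneg fun _ _ => cellEnergy_nonneg _ _)
  rw [energy]
  apply le_antisymm
  · refine iSup_le fun k => ?_
    obtain ⟨m, hm, hk⟩ : ∃ m, n m ≤ k ∧ k < n (m + 1) := by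
      have hex : ∃ m, k < n (m + 1) := ⟨k, hx.strictMono.id_le (k + 1)⟩
      classical
      refine ⟨Nat.find hex, ?_, Nat.find_spec hex⟩
      rcases h : Nat.find hex with _ | m
      · rw [hx.zero]; exact Nat.zero_le _
      · exact not_lt.1 (Nat.find_min hex (m := m) (by omega))
    rw [graphEnergy_eq_sum hx hd hu hm hk, ENNReal.ofReal_sum_of_nonneg fun j _ => hnn j]
    exact ENNReal.sum_le_tsum _
  · rw [ENNReal.tsum_eq_iSup_nat]
    refine iSup_le fun m => ?_
    rw [← ENNReal.ofReal_sum_of_nonneg fun j _ => hnn j,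
      ← graphEnergy_eq_sum hx hd hu le_rfl (hx.strictMono (Nat.lt_add_one m))]
    exact le_iSup (fun k => ENNReal.ofReal (graphEnergy (Ω x) k u)) (n m)

end Expansion

/-! ### Harmonic functions on the domain -/

section Harmonic

variable {x a : ℝ} {n : ℕ → ℕ} {f h : Plane → ℝ}

lemma IsHarmonicWith.junctionLaplacian_eq_zero (hh : IsHarmonicWith x n a f h)
    {v : List (Fin 3)} {i j : Fin 3} {k : ℕ} (hij : i ≠ j)
    (h₁ : Above x (v ++ i :: List.replicate k j)) (h₂ : Above x (v ++ j :: List.replicate k i)) :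
    junctionLaplacian h v i j k = 0 :=
  SGDomain.junctionLaplacian_eq_zero hh.laplacian hh.continuousOn hij
    ((cell_subset_iff_above _).2 h₁) ((cell_subset_iff_above _).2 h₂)

lemma Above.append {l : List (Fin 3)} (hl : Above x l) (s : List (Fin 3)) : Above x (l ++ s) :=
  (cell_subset_iff_above _).1 ((cell_append_subset l s).trans ((cell_subset_iff_above _).2 hl))

lemma IsHarmonicWith.midpoint (hh : IsHarmonicWith x n a f h) {l : List (Fin 3)}
    (hl : Above x l) {i j : Fin 3} (hij : i ≠ j) : junctionLaplacian h l i j 0 = 0 :=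
  hh.junctionLaplacian_eq_zero hij (hl.append _) (hl.append _)

lemma IsHarmonicWith.cellEnergy_refine (hh : IsHarmonicWith x n a f h) {l : List (Fin 3)}
    (hl : Above x l) : ∑ b, cellEnergy h (l ++ [b]) = 3 / 5 * cellEnergy h l := by
  have e1 := hh.midpoint hl (i := 0) (j := 1) (by decide)
  have e2 := hh.midpoint hl (i := 0) (j := 2) (by decide)
  have e3 := hh.midpoint hl (i := 1) (j := 2) (by decide)
  simp only [junctionLaplacian, normalDeriv, List.replicate_zero, Fin.sum_univ_three,
    cell_append_singleton_q_self, cell_append_singleton_q_comm l 1 0,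
    cell_append_singleton_q_comm l 2 0, cell_append_singleton_q_comm l 2 1] at e1 e2 e3
  simp only [cellEnergy, Fin.sum_univ_three,
    cell_append_singleton_q_self, cell_append_singleton_q_comm l 1 0,
    cell_append_singleton_q_comm l 2 0, cell_append_singleton_q_comm l 2 1]
  generalize h (cell l (q 0)) = u0 at *
  generalize h (cell l (q 1)) = u1 at *
  generalize h (cell l (q 2)) = u2 at *
  generalize h (cell (l ++ [0]) (q 1)) = y1 at *
  generalize h (cell (l ++ [0]) (q 2)) = y2 at *
  generalize h (cell (l ++ [1]) (q 2)) = y3 at *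
  -- the `2/5, 2/5, 1/5` rule of harmonic extension
  obtain rfl : y1 = (2 * u0 + 2 * u1 + u2) / 5 := by linarith
  obtain rfl : y2 = (2 * u0 + u1 + 2 * u2) / 5 := by linarith
  obtain rfl : y3 = (u0 + 2 * u1 + 2 * u2) / 5 := by linarith
  ring

lemma IsHarmonicWith.normalDeriv_append_replicate (hh : IsHarmonicWith x n a f h)
    {l : List (Fin 3)} (hl : Above x l) (j : Fin 3) (k : ℕ) :
    normalDeriv h (l ++ List.replicate k j) j = (3 / 5) ^ k * normalDeriv h l j := by
  induction k with
  | zero => simp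
  | succ k ih =>
    obtain ⟨b, -, hbj⟩ := exists_third j j
    obtain ⟨c, hcj, hcb⟩ := exists_third j b
    have hjb := hbj.symm
    have hjc := hcj.symm
    have hbc := hcb.symm
    have hlk := hl.append (List.replicate k j)
    rw [normalDeriv_refine h _ hjb hjc hbc, hh.midpoint hlk hjb, hh.midpoint hlk hjc,
      hh.midpoint hlk hbc] at ih
    rw [List.replicate_succ', ← List.append_assoc, pow_succ]
    linarith

/-- The conductance of the edges of the maximal cells of generation `m`. -/
noncomputable def conductance (n : ℕ → ℕ) (m : ℕ) : ℝ := (5 / 3) ^ n (m + 1)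

/-- The value of `u` at the top vertex of the maximal cell that belongs to `ω`. -/
noncomputable def topValue (n : ℕ → ℕ) (u : Plane → ℝ) (m : ℕ) (ω : Fin m → Fin 2) : ℝ :=
  u (cellMap n m ω (q 0))

/-- The flux of `u` through the top vertex into the maximal cell that belongs to `ω`. -/
noncomputable def flux (n : ℕ → ℕ) (u : Plane → ℝ) (m : ℕ) (ω : Fin m → Fin 2) : ℝ :=
  conductance n m * normalDeriv u (triangle n m ω) 0

/-- The difference of the values of `u` at the bottom vertices of the maximal cell that belongs
to `ω`. -/
noncomputable def jump (n : ℕ → ℕ) (u : Plane → ℝ) (m : ℕ) (ω : Fin m → Fin 2) : ℝ :=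
  topValue n u (m + 1) (Fin.snoc ω 0) - topValue n u (m + 1) (Fin.snoc ω 1)

lemma conductance_pos (n : ℕ → ℕ) (m : ℕ) : 0 < conductance n m := by
  unfold conductance; positivity

lemma le_conductance_succ (hx : IsBinaryExpansion x n) (m : ℕ) :
    5 / 3 * conductance n m ≤ conductance n (m + 1) := by
  rw [conductance, conductance, ← pow_succ']
  exact pow_le_pow_right₀ (by norm_num) (hx.strictMono (Nat.lt_add_one (m + 1)))

/-- The flux through the top of a maximal cell is the flux out of the maximal cell above it. -/
lemma IsHarmonicWith.flux_snoc (hx : IsBinaryExpansion x n) (hh : IsHarmonicWith x n a f h)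
    (m : ℕ) (ω : Fin m → Fin 2) (i : Fin 2) :
    flux n h (m + 1) (Fin.snoc ω i)
      = -(conductance n m * normalDeriv h (triangle n m ω) i.succ) := by
  set k := n (m + 1 + 1) - n (m + 1) with hk
  have hlt := hx.strictMono (Nat.lt_add_one (m + 1))
  have hn : n (m + 1 + 1) = n (m + 1) + k := by omega
  set v := word n m ω ++ List.replicate (n (m + 1) - n m - 1) 0 with hv
  have h₁ : v ++ 0 :: List.replicate k i.succ
      = triangle n m ω ++ List.replicate k i.succ := by
    rw [triangle_eq hx]; simp [hv]
  have h₂ : v ++ i.succ :: List.replicate k 0 = triangle n (m + 1) (Fin.snoc ω i) := by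
    rw [triangle, word_snoc]; simp [hv, hk]
  have h0 := hh.junctionLaplacian_eq_zero (v := v) (i := 0) (j := i.succ) (k := k)
    (Fin.succ_ne_zero i).symm (by rw [h₁]; exact (above_triangle hx m ω).append _)
    (by rw [h₂]; exact above_triangle hx _ _)
  rw [junctionLaplacian, h₁, h₂, hh.normalDeriv_append_replicate (above_triangle hx m ω)] at h0
  have h53 : (5 / 3 : ℝ) ^ k * (3 / 5) ^ k = 1 := by rw [← mul_pow]; norm_num
  rw [flux, conductance, conductance, hn, pow_add]
  linear_combination (-(5 / 3 : ℝ) ^ n (m + 1) * (5 / 3 : ℝ) ^ k) * h0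
    - (5 / 3 : ℝ) ^ n (m + 1) * normalDeriv h (triangle n m ω) i.succ * h53

lemma topValue_triangle_zero (u : Plane → ℝ) (m : ℕ) (ω : Fin m → Fin 2) :
    u (cell (triangle n m ω) (q 0)) = topValue n u m ω := by
  rw [cell_triangle_top, topValue]

lemma topValue_triangle_one (hx : IsBinaryExpansion x n) (u : Plane → ℝ) (m : ℕ)
    (ω : Fin m → Fin 2) :
    u (cell (triangle n m ω) (q 1)) = topValue n u (m + 1) (Fin.snoc ω 0) :=
  congrArg u (cell_triangle_bottom hx m ω 0)

lemma topValue_triangle_two (hx : IsBinaryExpansion x n) (u : Plane → ℝ) (m : ℕ)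
    (ω : Fin m → Fin 2) :
    u (cell (triangle n m ω) (q 2)) = topValue n u (m + 1) (Fin.snoc ω 1) :=
  congrArg u (cell_triangle_bottom hx m ω 1)

lemma flux_eq (hx : IsBinaryExpansion x n) (u : Plane → ℝ) (m : ℕ) (ω : Fin m → Fin 2) :
    flux n u m ω = conductance n m * (2 * topValue n u m ω
      - (topValue n u (m + 1) (Fin.snoc ω 0) + topValue n u (m + 1) (Fin.snoc ω 1))) := by
  rw [flux, normalDeriv, Fin.sum_univ_three, topValue_triangle_zero u, topValue_triangle_one hx u,
    topValue_triangle_two hx u]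
  ring

lemma IsHarmonicWith.flux_add (hx : IsBinaryExpansion x n) (hh : IsHarmonicWith x n a f h)
    (m : ℕ) (ω : Fin m → Fin 2) :
    flux n h (m + 1) (Fin.snoc ω 0) + flux n h (m + 1) (Fin.snoc ω 1) = flux n h m ω := by
  rw [hh.flux_snoc hx, hh.flux_snoc hx, flux]
  simp only [normalDeriv, Fin.sum_univ_three, Fin.succ_zero_eq_one, Fin.succ_one_eq_two]
  ring

lemma IsHarmonicWith.flux_sub (hx : IsBinaryExpansion x n) (hh : IsHarmonicWith x n a f h)
    (m : ℕ) (ω : Fin m → Fin 2) :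
    flux n h (m + 1) (Fin.snoc ω 0) - flux n h (m + 1) (Fin.snoc ω 1)
      = -3 * conductance n m * jump n h m ω := by
  rw [hh.flux_snoc hx, hh.flux_snoc hx, jump, ← topValue_triangle_one hx,
    ← topValue_triangle_two hx]
  simp only [normalDeriv, Fin.sum_univ_three, Fin.succ_zero_eq_one, Fin.succ_one_eq_two]
  ring

lemma conductance_mul_cellEnergy (hx : IsBinaryExpansion x n) (u : Plane → ℝ) (m : ℕ)
    (ω : Fin m → Fin 2) :
    conductance n m * cellEnergy u (triangle n m ω)
      = flux n u m ω ^ 2 / (2 * conductance n m) + 3 / 2 * (conductance n m * jump n u m ω ^ 2) := by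
  have := (conductance_pos n m).ne'
  rw [flux_eq hx, jump, cellEnergy, topValue_triangle_zero u, topValue_triangle_one hx u,
    topValue_triangle_two hx u]
  field_simp
  ring

/-! ### The energy in terms of fluxes and jumps -/

/-- The energy of the fluxes of generation `m`. -/
noncomputable def fluxEnergy (n : ℕ → ℕ) (u : Plane → ℝ) (m : ℕ) : ℝ :=
  (∑ ω : Fin m → Fin 2, flux n u m ω ^ 2) / conductance n m

/-- The energy of the jumps of generation `m`. -/
noncomputable def jumpEnergy (n : ℕ → ℕ) (u : Plane → ℝ) (m : ℕ) : ℝ :=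
  conductance n m * ∑ ω : Fin m → Fin 2, jump n u m ω ^ 2

lemma fluxEnergy_nonneg (n : ℕ → ℕ) (u : Plane → ℝ) (m : ℕ) : 0 ≤ fluxEnergy n u m :=
  div_nonneg (Finset.sum_nonneg fun _ _ => sq_nonneg _) (conductance_pos n m).le

lemma jumpEnergy_nonneg (n : ℕ → ℕ) (u : Plane → ℝ) (m : ℕ) : 0 ≤ jumpEnergy n u m :=
  mul_nonneg (conductance_pos n m).le (Finset.sum_nonneg fun _ _ => sq_nonneg _)

lemma IsHarmonicWith.energy_eq (hx : IsBinaryExpansion x n) (hd : ∀ j k : ℕ, x ≠ j / 2 ^ k)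
    (hh : IsHarmonicWith x n a f h) :
    energy (Ω x) h
      = ∑' m, ENNReal.ofReal (1 / 2 * fluxEnergy n h m + 3 / 2 * jumpEnergy n h m) := by
  rw [energy_eq_tsum hx hd fun l hl => hh.cellEnergy_refine hl]
  refine tsum_congr fun m => congrArg _ ?_
  have : (5 / 3 : ℝ) ^ n (m + 1) = conductance n m := rfl
  rw [this, Finset.mul_sum, Finset.sum_congr rfl fun ω _ => conductance_mul_cellEnergy hx h m ω,
    Finset.sum_add_distrib, ← Finset.sum_div, ← Finset.mul_sum, ← Finset.mul_sum, fluxEnergy,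
    jumpEnergy]
  have := (conductance_pos n m).ne'
  field_simp

/-- The fluxes decay geometrically, up to what the jumps contribute. -/
lemma IsHarmonicWith.fluxEnergy_succ_le (hx : IsBinaryExpansion x n)
    (hh : IsHarmonicWith x n a f h) (m : ℕ) :
    fluxEnergy n h (m + 1) ≤ 3 / 10 * fluxEnergy n h m + 27 / 10 * jumpEnergy n h m := by
  have e : ∑ ω : Fin (m + 1) → Fin 2, flux n h (m + 1) ω ^ 2
      = 1 / 2 * ∑ ω : Fin m → Fin 2, flux n h m ω ^ 2
        + 9 / 2 * conductance n m ^ 2 * ∑ ω : Fin m → Fin 2, jump n h m ω ^ 2 := by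
    rw [sum_snoc, Finset.mul_sum, Finset.mul_sum, ← Finset.sum_add_distrib]
    refine Finset.sum_congr rfl fun ω _ => ?_
    have h1 := hh.flux_add hx m ω
    have h2 := hh.flux_sub hx m ω
    rw [Fin.sum_univ_two, ← h1]
    have h3 : 9 / 2 * conductance n m ^ 2 * jump n h m ω ^ 2
      = 1 / 2 * (-3 * conductance n m * jump n h m ω) ^ 2 := by ring
    rw [h3, ← h2]
    ring
  have hr := conductance_pos n m
  have hr' := conductance_pos n (m + 1)
  have h4 : fluxEnergy n h (m + 1) ≤
      (∑ ω : Fin (m + 1) → Fin 2, flux n h (m + 1) ω ^ 2) / (5 / 3 * conductance n m) :=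
    div_le_div_of_nonneg_left (Finset.sum_nonneg fun _ _ => sq_nonneg _) (by positivity)
      (le_conductance_succ hx m)
  refine h4.trans_eq ?_
  rw [e, fluxEnergy, jumpEnergy]
  field_simp
  ring

lemma IsHarmonicWith.sum_fluxEnergy_le (hx : IsBinaryExpansion x n)
    (hh : IsHarmonicWith x n a f h) (N : ℕ) :
    ∑ m ∈ Finset.range N, fluxEnergy n h m
      ≤ 10 / 7 * fluxEnergy n h 0 + 27 / 7 * ∑ m ∈ Finset.range N, jumpEnergy n h m := by
  -- the last term makes the inequality inductive: `1 + 10/7 * 3/10 = 10/7`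
  suffices hs : ∑ m ∈ Finset.range N, fluxEnergy n h m + 10 / 7 * fluxEnergy n h N
      ≤ 10 / 7 * fluxEnergy n h 0 + 27 / 7 * ∑ m ∈ Finset.range N, jumpEnergy n h m by
    linarith [fluxEnergy_nonneg n h N]
  induction N with
  | zero => simp
  | succ N ih =>
    rw [Finset.sum_range_succ, Finset.sum_range_succ]
    linarith [hh.fluxEnergy_succ_le hx N]

/-! ### Effective resistances -/

/-- The effective resistance between the top vertex of a maximal cell of generation `m` and the
part of the boundary below it, along which the values of the harmonic function are averaged. -/
noncomputable def resistance (n : ℕ → ℕ) (m : ℕ) : ℝ :=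
  ∑' k, (1 / 2) ^ k / (2 * conductance n (m + k))

lemma le_conductance_add (hx : IsBinaryExpansion x n) (m k : ℕ) :
    (5 / 3) ^ k * conductance n m ≤ conductance n (m + k) := by
  induction k with
  | zero => simp
  | succ k ih =>
    have := le_conductance_succ hx (m + k)
    rw [pow_succ]
    rw [← add_assoc]
    linarith

lemma resistance_term_le (hx : IsBinaryExpansion x n) (m k : ℕ) :
    (1 / 2) ^ k / (2 * conductance n (m + k)) ≤ (3 / 10) ^ k * (1 / (2 * conductance n m)) := by
  have h0 := conductance_pos n m
  have h1 := le_conductance_add hx m k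
  calc (1 / 2) ^ k / (2 * conductance n (m + k))
      ≤ (1 / 2) ^ k / (2 * ((5 / 3) ^ k * conductance n m)) := by gcongr
    _ = ((1 / 2) ^ k / (5 / 3) ^ k) * (1 / (2 * conductance n m)) := by field_simp
    _ = (3 / 10) ^ k * (1 / (2 * conductance n m)) := by rw [← div_pow]; norm_num

lemma hasSum_resistance (hx : IsBinaryExpansion x n) (m : ℕ) :
    HasSum (fun k => (1 / 2) ^ k / (2 * conductance n (m + k))) (resistance n m) := by
  refine (Summable.of_nonneg_of_le (fun k => ?_) (resistance_term_le hx m)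
    ((summable_geometric_of_lt_one (by norm_num) (by norm_num)).mul_right _)).hasSum
  have := conductance_pos n (m + k)
  positivity

lemma conductance_mul_resistance_le (hx : IsBinaryExpansion x n) (m : ℕ) :
    conductance n m * resistance n m ≤ 5 / 7 := by
  have h0 := conductance_pos n m
  have h1 := hasSum_le (resistance_term_le hx m) (hasSum_resistance hx m)
    ((hasSum_geometric_of_lt_one (r := (3 / 10 : ℝ)) (by norm_num) (by norm_num)).mul_right
      (1 / (2 * conductance n m)))
  calc conductance n m * resistance n m
      ≤ conductance n m * ((1 - 3 / 10)⁻¹ * (1 / (2 * conductance n m))) := by gcongr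
    _ = 5 / 7 := by field_simp; norm_num

lemma half_le_conductance_mul_resistance (hx : IsBinaryExpansion x n) (m : ℕ) :
    1 / 2 ≤ conductance n m * resistance n m := by
  have h0 := conductance_pos n m
  have h1 := le_hasSum (hasSum_resistance hx m) 0 fun k _ => by
    have := conductance_pos n (m + k)
    positivity
  simp only [pow_zero, add_zero] at h1
  calc (1 / 2 : ℝ) = conductance n m * (1 / (2 * conductance n m)) := by field_simp
    _ ≤ _ := by gcongr

lemma resistance_nonneg (hx : IsBinaryExpansion x n) (m : ℕ) : 0 ≤ resistance n m := by
  have h0 := conductance_pos n m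
  have h1 := half_le_conductance_mul_resistance hx m
  by_contra h
  push Not at h
  nlinarith

end Harmonic

/-! ### Integrals over cylinders -/

/-- The initial segment of length `m` of an infinite word. -/
def initSeg (m : ℕ) (σ : ℕ → Fin 2) : Fin m → Fin 2 := fun i => σ i

/-- The set of the infinite words with initial segment `ω`. -/
def cylinder (m : ℕ) (ω : Fin m → Fin 2) : Set (ℕ → Fin 2) := initSeg m ⁻¹' {ω}

lemma measurable_initSeg (m : ℕ) : Measurable (initSeg m) :=
  measurable_pi_lambda _ fun i => measurable_pi_apply (i : ℕ)

lemma measurableSet_cylinder (m : ℕ) (ω : Fin m → Fin 2) : MeasurableSet (cylinder m ω) :=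
  measurable_initSeg m (measurableSet_singleton ω)

lemma coin_cylinder (m : ℕ) (ω : Fin m → Fin 2) : coin (cylinder m ω) = 2⁻¹ ^ m := by
  have h1 : cylinder m ω = (Finset.range m : Set ℕ).pi
      fun i => {b | ∀ h : i < m, b = ω ⟨i, h⟩} := by
    ext σ
    simp only [cylinder, initSeg, Set.mem_preimage, Set.mem_singleton_iff, funext_iff, Set.mem_pi,
      Finset.coe_range, Set.mem_Iio, Set.mem_ofPred_eq]
    exact ⟨fun h i hi hi' => h ⟨i, hi'⟩, fun h i => h i i.2 i.2⟩
  rw [h1, coin, Measure.infinitePi_pi _ fun i _ => MeasurableSet.of_discrete]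
  have h2 : ∀ i ∈ Finset.range m, (ProbabilityTheory.uniformOn (Set.univ : Set (Fin 2)))
      {b | ∀ h : i < m, b = ω ⟨i, h⟩} = 2⁻¹ := by
    intro i hi
    have h3 : {b | ∀ h : i < m, b = ω ⟨i, h⟩} = {ω ⟨i, Finset.mem_range.1 hi⟩} := by
      ext b
      simp [Finset.mem_range.1 hi]
    rw [h3, ProbabilityTheory.uniformOn_univ, Measure.count_singleton]
    simp
  rw [Finset.prod_congr rfl h2]
  simp

lemma integrable_comp_initSeg (m : ℕ) (φ : (Fin m → Fin 2) → ℝ) :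
    Integrable (fun σ => φ (initSeg m σ)) coin :=
  Integrable.of_finite.comp_measurable (measurable_initSeg m)

lemma integral_comp_initSeg (m : ℕ) (φ : (Fin m → Fin 2) → ℝ) :
    ∫ σ, φ (initSeg m σ) ∂coin = (1 / 2) ^ m * ∑ ω, φ ω := by
  rw [← integral_map (measurable_initSeg m).aemeasurable
    (AEStronglyMeasurable.of_discrete), integral_fintype Integrable.of_finite, Finset.mul_sum]
  refine Finset.sum_congr rfl fun ω _ => ?_
  rw [map_measureReal_apply (measurable_initSeg m) (measurableSet_singleton ω), measureReal_def]
  change (coin (cylinder m ω)).toReal • _ = _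
  rw [coin_cylinder]
  simp

lemma setIntegral_cylinder_self (m : ℕ) (ω : Fin m → Fin 2) (φ : (Fin m → Fin 2) → ℝ) :
    ∫ σ in cylinder m ω, φ (initSeg m σ) ∂coin = (1 / 2) ^ m * φ ω := by
  rw [setIntegral_congr_fun (g := fun _ => φ ω) (measurableSet_cylinder m ω)
    fun σ hσ => by rw [show initSeg m σ = ω from hσ], setIntegral_const, measureReal_def,
    coin_cylinder]
  simp

/-- Averaging over the last letter. -/
lemma setIntegral_cylinder_succ (m d : ℕ) (ω : Fin m → Fin 2)
    (φ : (Fin (m + d + 1) → Fin 2) → ℝ) :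
    ∫ σ in cylinder m ω, φ (initSeg (m + d + 1) σ) ∂coin
      = ∫ σ in cylinder m ω, (φ (Fin.snoc (initSeg (m + d) σ) 0)
        + φ (Fin.snoc (initSeg (m + d) σ) 1)) / 2 ∂coin := by
  classical
  rw [← integral_indicator (measurableSet_cylinder m ω),
    ← integral_indicator (measurableSet_cylinder m ω)]
  have h1 := integral_comp_initSeg (m + d + 1) fun τ =>
    if (fun i : Fin m => τ ⟨i, by omega⟩) = ω then φ τ else 0
  have h2 := integral_comp_initSeg (m + d) fun τ =>
    if (fun i : Fin m => τ ⟨i, by omega⟩) = ω then (φ (Fin.snoc τ 0) + φ (Fin.snoc τ 1)) / 2 else 0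
  have e : ∀ ψ : (ℕ → Fin 2) → ℝ, (cylinder m ω).indicator ψ
      = fun σ => if initSeg m σ = ω then ψ σ else 0 := by
    intro ψ; funext σ; rw [Set.indicator_apply]; exact if_congr Iff.rfl rfl rfl
  rw [e, e]
  refine h1.trans (Eq.trans ?_ h2.symm)
  rw [sum_snoc, Finset.mul_sum, Finset.mul_sum]
  refine Finset.sum_congr rfl fun τ _ => ?_
  have h3 : ∀ a : Fin 2, (fun i : Fin m => (Fin.snoc τ a : Fin (m + d + 1) → Fin 2)
      ⟨i, by omega⟩) = fun i : Fin m => τ ⟨i, by omega⟩ := by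
    intro a
    funext i
    exact Fin.snoc_castSucc (α := fun _ => Fin 2) a τ ⟨i, by omega⟩
  simp only [h3, Fin.sum_univ_two]
  split_ifs <;> ring

section Trace

variable {x a : ℝ} {n : ℕ → ℕ} {f h : Plane → ℝ}

lemma IsHarmonicWith.setIntegral_flux (hx : IsBinaryExpansion x n) (hh : IsHarmonicWith x n a f h)
    (m d : ℕ) (ω : Fin m → Fin 2) :
    ∫ σ in cylinder m ω, flux n h (m + d) (initSeg (m + d) σ) ∂coin
      = (1 / 2) ^ m * ((1 / 2) ^ d * flux n h m ω) := by
  induction d with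
  | zero => simpa using setIntegral_cylinder_self m ω (flux n h m)
  | succ d ih =>
    have h1 := setIntegral_cylinder_succ m d ω (flux n h (m + d + 1))
    simp_rw [hh.flux_add hx] at h1
    rw [integral_div, ih] at h1
    refine h1.trans ?_
    rw [pow_succ]
    ring

/-- The averages of the values of a harmonic function over the maximal cells of a generation
below a given one are governed by the flux into the latter. -/
lemma IsHarmonicWith.setIntegral_topValue (hx : IsBinaryExpansion x n)
    (hh : IsHarmonicWith x n a f h) (m d : ℕ) (ω : Fin m → Fin 2) :
    ∫ σ in cylinder m ω, topValue n h (m + d) (initSeg (m + d) σ) ∂coin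
      = (1 / 2) ^ m * (topValue n h m ω - flux n h m ω *
        ∑ k ∈ Finset.range d, (1 / 2) ^ k / (2 * conductance n (m + k))) := by
  induction d with
  | zero => simpa using setIntegral_cylinder_self m ω (topValue n h m)
  | succ d ih =>
    have h1 := setIntegral_cylinder_succ m d ω (topValue n h (m + d + 1))
    have h2 : ∀ τ : Fin (m + d) → Fin 2, (topValue n h (m + d + 1) (Fin.snoc τ 0)
        + topValue n h (m + d + 1) (Fin.snoc τ 1)) / 2
        = topValue n h (m + d) τ - flux n h (m + d) τ / (2 * conductance n (m + d)) := by
      intro τ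
      have := (conductance_pos n (m + d)).ne'
      rw [flux_eq hx]
      field_simp
      ring
    simp_rw [h2] at h1
    rw [integral_sub (integrable_comp_initSeg _ _).integrableOn
      ((integrable_comp_initSeg _ _).div_const _).integrableOn, integral_div, ih,
      hh.setIntegral_flux hx] at h1
    refine h1.trans ?_
    rw [Finset.sum_range_succ]
    ring

lemma isClosed_S (x : ℝ) : IsClosed (S x) := by
  have : S x = gasket ∩ {p : Plane | p 1 = 1 - x} := rfl
  rw [this]
  exact isCompact_gasket.isClosed.inter (isClosed_eq (continuous_bary 0) continuous_const)

lemma restrict_cantorMeasure (hx : IsBinaryExpansion x n) :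
    (cantorMeasure n).restrict (S x) = cantorMeasure n := by
  refine Measure.restrict_eq_self_of_ae_mem ?_
  exact (ae_map_iff (p := (· ∈ S x)) (continuous_boundaryPoint hx).measurable.aemeasurable
    (isClosed_S x).measurableSet).2 (Eventually.of_forall fun σ => boundaryPoint_mem hx σ)

lemma integrable_comp_boundaryPoint (hx : IsBinaryExpansion x n)
    (hf : IntegrableOn f (S x) (cantorMeasure n)) :
    Integrable (fun σ => f (boundaryPoint n σ)) coin := by
  rw [IntegrableOn, restrict_cantorMeasure hx] at hf
  exact hf.comp_measurable (continuous_boundaryPoint hx).measurable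

/-- The average of the boundary values over a piece of the boundary differs from the value at the
top of the maximal cell above by flux times effective resistance. -/
lemma IsHarmonicWith.setIntegral_boundary (hx : IsBinaryExpansion x n)
    (hh : IsHarmonicWith x n a f h) (hf : IntegrableOn f (S x) (cantorMeasure n)) (m : ℕ)
    (ω : Fin m → Fin 2) :
    ∫ σ in cylinder m ω, f (boundaryPoint n σ) ∂coin
      = (1 / 2) ^ m * (topValue n h m ω - flux n h m ω * resistance n m) := by
  have h1 := tendsto_setIntegral_of_L1 (μ := coin) (fun σ => f (boundaryPoint n σ))
    (integrable_comp_boundaryPoint hx hf).aestronglyMeasurable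
    (Eventually.of_forall fun M => integrable_comp_initSeg M (topValue n h M)) hh.trace
    (cylinder m ω)
  have h2 := h1.comp (tendsto_add_atTop_nat m)
  refine tendsto_nhds_unique h2 ?_
  have h3 := (((hasSum_resistance hx m).tendsto_sum_nat.const_mul (flux n h m ω)).const_sub
    (topValue n h m ω)).const_mul ((1 / 2) ^ m)
  refine h3.congr fun d => ?_
  rw [← hh.setIntegral_topValue hx, add_comm]
  rfl

/-! ### Haar coefficients -/

lemma boundaryPoint_mem_cell (hx : IsBinaryExpansion x n) (σ : ℕ → Fin 2) (m : ℕ) :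
    boundaryPoint n σ ∈ cell (word n m (initSeg m σ)) '' gasket := by
  have hsub : ∀ d, cell (word n (m + d) (initSeg (m + d) σ)) '' gasket
      ⊆ cell (word n m (initSeg m σ)) '' gasket := by
    intro d
    induction d with
    | zero => exact subset_rfl
    | succ d ih => exact (cell_append_subset _ _).trans ih
  have h1 := (tendsto_cellMap hx σ (q 0)).comp (tendsto_add_atTop_nat m)
  refine (isCompact_cell _).isClosed.mem_of_tendsto h1 (Eventually.of_forall fun d => ?_)
  rw [Function.comp_apply, cellMap_eq_cell, add_comm]
  exact hsub d ⟨q 0, q_mem 0, rfl⟩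

/-- The pieces of the boundary correspond to the cylinders. Two cells of the same level share at
most corners, and these are at dyadic heights, where the line is not. -/
lemma boundaryPoint_mem_piece (hx : IsBinaryExpansion x n) (hd : ∀ j k : ℕ, x ≠ j / 2 ^ k)
    (σ : ℕ → Fin 2) (m : ℕ) (ω : Fin m → Fin 2) :
    boundaryPoint n σ ∈ piece x n m ω ↔ σ ∈ cylinder m ω := by
  rw [piece, cellMap_eq_cell]
  constructor
  · rintro ⟨hS, p', hp', h'⟩
    obtain ⟨p, hp, h⟩ := boundaryPoint_mem_cell hx σ m
    by_contra hne
    have hw : word n m (initSeg m σ) ≠ word n m ω := fun hw => hne (word_injective n m hw)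
    obtain ⟨b, rfl⟩ := eq_q_of_cell_eq (by rw [length_word hx, length_word hx]) hw hp hp'
      (h.trans h'.symm)
    obtain ⟨j, hj⟩ := exists_height_corner (word n m (initSeg m σ)) b
    rw [h, hS.2] at hj
    exact hd j _ (by rw [← hj]; ring)
  · intro hσ
    have := boundaryPoint_mem_cell hx σ m
    rw [show initSeg m σ = ω from hσ] at this
    exact ⟨boundaryPoint_mem hx σ, this⟩

lemma measurableSet_piece (x : ℝ) (n : ℕ → ℕ) (m : ℕ) (ω : Fin m → Fin 2) :
    MeasurableSet (piece x n m ω) := by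
  rw [piece, cellMap_eq_cell]
  exact (isClosed_S x).measurableSet.inter (isCompact_cell _).isClosed.measurableSet

lemma measurable_haar (x : ℝ) (n : ℕ → ℕ) (m : ℕ) (ω : Fin m → Fin 2) :
    Measurable (haar x n m ω) :=
  Measurable.ite (measurableSet_piece _ _ _ _) measurable_const
    (Measurable.ite (measurableSet_piece _ _ _ _) measurable_const measurable_const)

lemma haarCoeff_eq_sub (hx : IsBinaryExpansion x n) (hd : ∀ j k : ℕ, x ≠ j / 2 ^ k)
    (hf : IntegrableOn f (S x) (cantorMeasure n)) (m : ℕ) (ω : Fin m → Fin 2) :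
    haarCoeff x n f m ω = 2 ^ ((m : ℝ) / 2) *
      (∫ σ in cylinder (m + 1) (Fin.snoc ω 0), f (boundaryPoint n σ) ∂coin
        - ∫ σ in cylinder (m + 1) (Fin.snoc ω 1), f (boundaryPoint n σ) ∂coin) := by
  classical
  have hfi := integrable_comp_boundaryPoint hx hf
  have hf' := hf
  rw [IntegrableOn, restrict_cantorMeasure hx] at hf'
  rw [haarCoeff, restrict_cantorMeasure hx, cantorMeasure, integral_map
    (f := fun p => f p * haar x n m ω p) (continuous_boundaryPoint hx).measurable.aemeasurable
    (hf'.aestronglyMeasurable.mul (measurable_haar x n m ω).aestronglyMeasurable),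
    ← integral_indicator (measurableSet_cylinder _ _),
    ← integral_indicator (measurableSet_cylinder _ _),
    ← integral_sub (hfi.indicator (measurableSet_cylinder _ _))
      (hfi.indicator (measurableSet_cylinder _ _)), ← integral_const_mul]
  refine integral_congr_ae (Eventually.of_forall fun σ => ?_)
  have hne : σ ∈ cylinder (m + 1) (Fin.snoc ω 0) → σ ∉ cylinder (m + 1) (Fin.snoc ω 1) := by
    intro h0 h1
    have h2 : (Fin.snoc ω 0 : Fin (m + 1) → Fin 2) = Fin.snoc ω 1 := h0.symm.trans h1
    have h3 := congrFun h2 (Fin.last m)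
    simp at h3
  simp only [haar, boundaryPoint_mem_piece hx hd, Set.indicator_apply]
  split_ifs with h0 h1 h1
  · exact absurd h1 (hne h0)
  all_goals ring

lemma IsHarmonicWith.haarCoeff_eq (hx : IsBinaryExpansion x n) (hd : ∀ j k : ℕ, x ≠ j / 2 ^ k)
    (hh : IsHarmonicWith x n a f h) (hf : IntegrableOn f (S x) (cantorMeasure n)) (m : ℕ)
    (ω : Fin m → Fin 2) :
    haarCoeff x n f m ω = 2 ^ ((m : ℝ) / 2) * ((1 / 2) ^ (m + 1) *
      (jump n h m ω * (1 + 3 * (conductance n m * resistance n (m + 1))))) := by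
  rw [haarCoeff_eq_sub hx hd hf, hh.setIntegral_boundary hx hf, hh.setIntegral_boundary hx hf]
  have h1 := hh.flux_sub hx m ω
  rw [jump] at h1 ⊢
  linear_combination (-(2 : ℝ) ^ ((m : ℝ) / 2) * (1 / 2) ^ (m + 1) * resistance n (m + 1)) * h1

lemma IsHarmonicWith.haar_term_eq (hx : IsBinaryExpansion x n) (hd : ∀ j k : ℕ, x ≠ j / 2 ^ k)
    (hh : IsHarmonicWith x n a f h) (hf : IntegrableOn f (S x) (cantorMeasure n)) (m : ℕ)
    (ω : Fin m → Fin 2) :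
    2 ^ m * (5 / 3) ^ n (m + 1) * |haarCoeff x n f m ω| ^ 2
      = (1 + 3 * (conductance n m * resistance n (m + 1))) ^ 2 / 4 *
        (conductance n m * jump n h m ω ^ 2) := by
  have h1 : ((2 : ℝ) ^ ((m : ℝ) / 2)) ^ 2 = 2 ^ m := by
    rw [← Real.rpow_natCast, ← Real.rpow_mul (by norm_num)]
    simp
  have h2 : (2 : ℝ) ^ m * 2 ^ m * ((1 / 2) ^ m * (1 / 2) ^ m) = 1 := by
    rw [← mul_pow, ← mul_pow, ← mul_pow]; norm_num
  rw [sq_abs, hh.haarCoeff_eq hx hd hf, mul_pow, h1, conductance, pow_succ]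
  linear_combination ((5 / 3 : ℝ) ^ n (m + 1) * jump n h m ω ^ 2
    * (1 + 3 * ((5 / 3 : ℝ) ^ n (m + 1) * resistance n (m + 1))) ^ 2 / 4) * h2

lemma conductance_mul_resistance_succ_le (hx : IsBinaryExpansion x n) (m : ℕ) :
    conductance n m * resistance n (m + 1) ≤ 3 / 7 := by
  have h1 := conductance_mul_resistance_le hx (m + 1)
  have h2 := le_conductance_succ hx m
  have h3 := resistance_nonneg hx (m + 1)
  nlinarith

/-- The sum of the terms of generation `m` in the quadratic form of the Haar coefficients. -/
noncomputable def haarEnergy (x : ℝ) (n : ℕ → ℕ) (f : Plane → ℝ) (m : ℕ) : ℝ :=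
  ∑ ω : Fin m → Fin 2, 2 ^ m * (5 / 3) ^ n (m + 1) * |haarCoeff x n f m ω| ^ 2

lemma haarEnergy_nonneg (x : ℝ) (n : ℕ → ℕ) (f : Plane → ℝ) (m : ℕ) : 0 ≤ haarEnergy x n f m :=
  Finset.sum_nonneg fun _ _ => by positivity

lemma IsHarmonicWith.haarEnergy_eq (hx : IsBinaryExpansion x n) (hd : ∀ j k : ℕ, x ≠ j / 2 ^ k)
    (hh : IsHarmonicWith x n a f h) (hf : IntegrableOn f (S x) (cantorMeasure n)) (m : ℕ) :
    haarEnergy x n f m = (1 + 3 * (conductance n m * resistance n (m + 1))) ^ 2 / 4 *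
      jumpEnergy n h m := by
  rw [haarEnergy, Finset.sum_congr rfl fun ω _ => hh.haar_term_eq hx hd hf m ω, jumpEnergy,
    Finset.mul_sum, Finset.mul_sum]

lemma IsHarmonicWith.jumpEnergy_le (hx : IsBinaryExpansion x n) (hd : ∀ j k : ℕ, x ≠ j / 2 ^ k)
    (hh : IsHarmonicWith x n a f h) (hf : IntegrableOn f (S x) (cantorMeasure n)) (m : ℕ) :
    jumpEnergy n h m ≤ 4 * haarEnergy x n f m := by
  rw [hh.haarEnergy_eq hx hd hf]
  have h1 : 0 ≤ conductance n m * resistance n (m + 1) :=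
    mul_nonneg (conductance_pos n m).le (resistance_nonneg hx _)
  have h2 := jumpEnergy_nonneg n h m
  have h3 : 1 ≤ (1 + 3 * (conductance n m * resistance n (m + 1))) ^ 2 :=
    one_le_pow₀ (by linarith)
  nlinarith

lemma IsHarmonicWith.haarEnergy_le (hx : IsBinaryExpansion x n) (hd : ∀ j k : ℕ, x ≠ j / 2 ^ k)
    (hh : IsHarmonicWith x n a f h) (hf : IntegrableOn f (S x) (cantorMeasure n)) (m : ℕ) :
    haarEnergy x n f m ≤ 2 * jumpEnergy n h m := by
  rw [hh.haarEnergy_eq hx hd hf]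
  have h1 : 0 ≤ conductance n m * resistance n (m + 1) :=
    mul_nonneg (conductance_pos n m).le (resistance_nonneg hx _)
  refine mul_le_mul_of_nonneg_right ?_ (jumpEnergy_nonneg n h m)
  have h3 : (1 + 3 * (conductance n m * resistance n (m + 1))) ^ 2 ≤ (16 / 7) ^ 2 :=
    pow_le_pow_left₀ (by linarith) (by linarith [conductance_mul_resistance_succ_le hx m]) 2
  linarith

/-! ### The mean value -/

lemma IsHarmonicWith.sub_integral_eq (hx : IsBinaryExpansion x n)
    (hh : IsHarmonicWith x n a f h) (hf : IntegrableOn f (S x) (cantorMeasure n)) :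
    a - ∫ p in S x, f p ∂cantorMeasure n = flux n h 0 0 * resistance n 0 := by
  have hf' := hf
  rw [IntegrableOn, restrict_cantorMeasure hx] at hf'
  have h1 := hh.setIntegral_boundary hx hf 0 0
  have h2 : cylinder 0 0 = Set.univ := Set.eq_univ_of_forall fun σ => Subsingleton.elim _ _
  have h3 : topValue n h 0 0 = a := hh.top
  rw [h2, Measure.restrict_univ, h3] at h1
  rw [restrict_cantorMeasure hx, cantorMeasure, integral_map
    (continuous_boundaryPoint hx).measurable.aemeasurable hf'.aestronglyMeasurable, h1]
  ring

lemma IsHarmonicWith.mean_term_eq (hx : IsBinaryExpansion x n)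
    (hh : IsHarmonicWith x n a f h) (hf : IntegrableOn f (S x) (cantorMeasure n)) :
    (5 / 3) ^ n 1 * (a - ∫ p in S x, f p ∂cantorMeasure n) ^ 2
      = (conductance n 0 * resistance n 0) ^ 2 * fluxEnergy n h 0 := by
  have h0 := (conductance_pos n 0).ne'
  have h1 : (5 / 3 : ℝ) ^ n 1 = conductance n 0 := rfl
  rw [hh.sub_integral_eq hx hf, fluxEnergy, h1, Fintype.sum_eq_single 0
    fun ω hω => absurd (Subsingleton.elim _ _) hω]
  field_simp

lemma IsHarmonicWith.fluxEnergy_zero_le (hx : IsBinaryExpansion x n)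
    (hh : IsHarmonicWith x n a f h) (hf : IntegrableOn f (S x) (cantorMeasure n)) :
    fluxEnergy n h 0 ≤ 4 * ((5 / 3) ^ n 1 * (a - ∫ p in S x, f p ∂cantorMeasure n) ^ 2) := by
  rw [hh.mean_term_eq hx hf]
  have h1 : (1 / 2) ^ 2 ≤ (conductance n 0 * resistance n 0) ^ 2 :=
    pow_le_pow_left₀ (by norm_num) (half_le_conductance_mul_resistance hx 0) 2
  nlinarith [fluxEnergy_nonneg n h 0]

lemma IsHarmonicWith.mean_term_le (hx : IsBinaryExpansion x n)
    (hh : IsHarmonicWith x n a f h) (hf : IntegrableOn f (S x) (cantorMeasure n)) :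
    (5 / 3) ^ n 1 * (a - ∫ p in S x, f p ∂cantorMeasure n) ^ 2 ≤ fluxEnergy n h 0 := by
  rw [hh.mean_term_eq hx hf]
  have h1 : (conductance n 0 * resistance n 0) ^ 2 ≤ 1 :=
    pow_le_one₀ (by linarith [half_le_conductance_mul_resistance hx 0])
      (by linarith [conductance_mul_resistance_le hx 0])
  nlinarith [fluxEnergy_nonneg n h 0]

/-! ### Comparison of the energy with the quadratic form -/

/-- The quadratic form in the mean value and the Haar coefficients of the boundary values. -/
noncomputable def boundaryForm (x : ℝ) (n : ℕ → ℕ) (a : ℝ) (f : Plane → ℝ) : ℝ≥0∞ :=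
  ENNReal.ofReal ((5 / 3) ^ n 1 * (a - ∫ p in S x, f p ∂cantorMeasure n) ^ 2)
    + ∑' m, ENNReal.ofReal (haarEnergy x n f m)

lemma IsHarmonicWith.boundaryForm_le (hx : IsBinaryExpansion x n)
    (hd : ∀ j k : ℕ, x ≠ j / 2 ^ k) (hh : IsHarmonicWith x n a f h)
    (hf : IntegrableOn f (S x) (cantorMeasure n)) :
    boundaryForm x n a f ≤ 2 * energy (Ω x) h := by
  have hX := fluxEnergy_nonneg n h
  have hD := jumpEnergy_nonneg n h
  calc boundaryForm x n a f
      ≤ ∑' m, ENNReal.ofReal (fluxEnergy n h m) + ∑' m, ENNReal.ofReal (2 * jumpEnergy n h m) := by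
        refine add_le_add ?_ (ENNReal.tsum_le_tsum fun m =>
          ENNReal.ofReal_le_ofReal (hh.haarEnergy_le hx hd hf m))
        exact (ENNReal.ofReal_le_ofReal (hh.mean_term_le hx hf)).trans (ENNReal.le_tsum 0)
    _ = ∑' m, ENNReal.ofReal (fluxEnergy n h m + 2 * jumpEnergy n h m) := by
        rw [← ENNReal.tsum_add]
        refine tsum_congr fun m => (ENNReal.ofReal_add (hX m) ?_).symm
        linarith [hD m]
    _ ≤ ∑' m, 2 * ENNReal.ofReal (1 / 2 * fluxEnergy n h m + 3 / 2 * jumpEnergy n h m) := by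
        refine ENNReal.tsum_le_tsum fun m => ?_
        rw [← ENNReal.ofReal_ofNat 2, ← ENNReal.ofReal_mul (by norm_num)]
        exact ENNReal.ofReal_le_ofReal (by linarith [hD m])
    _ = 2 * energy (Ω x) h := by rw [ENNReal.tsum_mul_left, hh.energy_eq hx hd]

lemma IsHarmonicWith.energy_le (hx : IsBinaryExpansion x n)
    (hd : ∀ j k : ℕ, x ≠ j / 2 ^ k) (hh : IsHarmonicWith x n a f h)
    (hf : IntegrableOn f (S x) (cantorMeasure n)) :
    energy (Ω x) h ≤ 14 * boundaryForm x n a f := by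
  have hX := fluxEnergy_nonneg n h
  have hD := jumpEnergy_nonneg n h
  have hH := haarEnergy_nonneg x n f
  rw [hh.energy_eq hx hd, ENNReal.tsum_eq_iSup_nat]
  refine iSup_le fun N => ?_
  rw [← ENNReal.ofReal_sum_of_nonneg fun m _ => by linarith [hX m, hD m]]
  have h1 : ∑ m ∈ Finset.range N, (1 / 2 * fluxEnergy n h m + 3 / 2 * jumpEnergy n h m)
      ≤ 14 * ((5 / 3) ^ n 1 * (a - ∫ p in S x, f p ∂cantorMeasure n) ^ 2
        + ∑ m ∈ Finset.range N, haarEnergy x n f m) := by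
    have e1 := hh.sum_fluxEnergy_le hx N
    have e2 := hh.fluxEnergy_zero_le hx hf
    have e3 : ∑ m ∈ Finset.range N, jumpEnergy n h m
        ≤ 4 * ∑ m ∈ Finset.range N, haarEnergy x n f m := by
      rw [Finset.mul_sum]
      exact Finset.sum_le_sum fun m _ => hh.jumpEnergy_le hx hd hf m
    have e4 : 0 ≤ ∑ m ∈ Finset.range N, haarEnergy x n f m := Finset.sum_nonneg fun m _ => hH m
    have e5 : 0 ≤ (5 / 3) ^ n 1 * (a - ∫ p in S x, f p ∂cantorMeasure n) ^ 2 := by positivity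
    rw [Finset.sum_add_distrib, ← Finset.mul_sum, ← Finset.mul_sum]
    linarith
  refine (ENNReal.ofReal_le_ofReal h1).trans ?_
  rw [ENNReal.ofReal_mul (by norm_num), ENNReal.ofReal_ofNat, ENNReal.ofReal_add (by positivity)
    (Finset.sum_nonneg fun m _ => hH m), ENNReal.ofReal_sum_of_nonneg fun m _ => hH m]
  gcongr
  exact add_le_add_right (ENNReal.sum_le_tsum _) _

end Trace

end SGDomain


theorem corollary2p5 :
    ∃ C₁ C₂ : ℝ≥0, 0 < C₁ ∧ 0 < C₂ ∧
      ∀ (x : ℝ) (n : ℕ → ℕ), 0 < x → x ≤ 1 → (∀ j k : ℕ, x ≠ j / 2 ^ k) →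
        SGDomain.IsBinaryExpansion x n →
      ∀ (a : ℝ) (f h : SGDomain.Plane → ℝ),
        IntegrableOn f (SGDomain.S x) (SGDomain.cantorMeasure n) →
        SGDomain.IsHarmonicWith x n a f h →
      ∀ (b : ℝ) (Q : ℝ≥0∞),
        b = ∫ p in SGDomain.S x, f p ∂SGDomain.cantorMeasure n →
        Q = ENNReal.ofReal ((5 / 3) ^ n 1 * (a - b) ^ 2)
          + ∑' m : ℕ, ∑ ω : Fin m → Fin 2,
              ENNReal.ofReal (2 ^ m * (5 / 3) ^ n (m + 1)
                * |SGDomain.haarCoeff x n f m ω| ^ 2) →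
        C₁ * Q ≤ SGDomain.energy (SGDomain.Ω x) h ∧
        SGDomain.energy (SGDomain.Ω x) h ≤ C₂ * Q ∧
        (SGDomain.energy (SGDomain.Ω x) h < ⊤ ↔ Q < ⊤) := by
  refine ⟨2⁻¹, 14, by norm_num, by norm_num, ?_⟩
  intro x n _ _ hd hx a f h hf hh b Q hb hQ
  have hQ' : Q = SGDomain.boundaryForm x n a f := by
    rw [hQ, hb, SGDomain.boundaryForm]
    congr 2
    funext m
    rw [SGDomain.haarEnergy, ENNReal.ofReal_sum_of_nonneg fun _ _ => by positivity]
  have h1 := hh.boundaryForm_le hx hd hf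
  have h2 := hh.energy_le hx hd hf
  rw [← hQ'] at h1 h2
  refine ⟨?_, by exact_mod_cast h2, fun h3 => ?_, fun h3 => ?_⟩
  · rw [ENNReal.coe_inv (by norm_num)]
    exact (ENNReal.inv_mul_le_iff (by norm_num) (by norm_num)).2 (by exact_mod_cast h1)
  · exact h1.trans_lt (ENNReal.mul_lt_top (by norm_num) h3)
  · exact h2.trans_lt (ENNReal.mul_lt_top (by norm_num) h3)
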